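/- Let $\rho$ be a positive (Hermitian positive semidefinite) $p\times p$ matrix-valued Borel measure on the unit circle, with Lebesgue decomposition $d\rho(\theta)=\rho'(\theta)\,\frac{d\theta}{2\pi}+d\rho_s(\theta)$, where $\rho_s$ is singular with respect to Lebesgue measure. Let $\varphi_0,\varphi_1,\varphi_2,\dots$ be left orthonormal matrix polynomials for $\rho$, that is, $\varphi_n$ is a polynomial of degree at most $n$ with coefficients in $\mathbb{C}^{p\times p}$ and $$\int_0^{2\pi}\varphi_n(z)\,d\rho(\theta)\,\varphi_m(z)^*=\delta_{m,n}I,\qquad z=e^{i\theta},\quad n,m\ge 0,$$ where $Q^*$ is the Hermitian transpose of $Q$. Let $\|\cdot\|_2$ denote the spectral norm. Then $$\det\rho'(\theta)>0\ \text{ for almost every }\theta\in[0,2\pi)$$ if and only if $$\lim_{n\to\infty}\ \sup_{\ell\ge 1}\ \frac1{2\pi}\int_0^{2\pi}\bigl\|\varphi_n(z)\,\varphi_{n+\ell}(z)^{-1}\,[\varphi_{n+\ell}(z)^*]^{-1}\,\varphi_n(z)^*-I\bigr\|_2\,d\theta=0 .$$ -/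

import Mathlib

open MeasureTheory Filter Topology Polynomial Matrix

open scoped ENNReal ComplexOrder

noncomputable section

namespace MatrixOPUC

instance factTwoPiPos : Fact (0 < 2 * Real.pi) := ⟨Real.two_pi_pos⟩

/-- The unit circle, parametrized by the angle `θ` modulo `2π`; the point of the circle that
belongs to `θ` is `circlePt θ = exp (i θ)`. -/
abbrev Angle : Type := AddCircle (2 * Real.pi)

/-- The point `z = exp (i θ)`. -/
def circlePt (θ : Angle) : ℂ := (AddCircle.toCircle θ : ℂ)

/-- Normalized Lebesgue measure `dθ / 2π` on the unit circle. -/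
def leb : Measure Angle := AddCircle.haarAddCircle

/-- A (positive) `p × p` Hermitian matrix-valued measure on the unit circle: a matrix of complex
measures whose value on every Borel set is a Hermitian positive semidefinite matrix. -/
structure MatrixMeasure (p : ℕ) where
  /-- the entries, complex measures -/
  entry : Fin p → Fin p → ComplexMeasure Angle
  /-- the value on each Borel set is Hermitian and positive semidefinite -/
  posSemidef : ∀ B : Set Angle, MeasurableSet B →
    (Matrix.of fun k l => entry k l B).PosSemidef

variable {p : ℕ}

/-- The integral `∫ f dc` of a complex function against a complex measure. -/
def cintegral (f : Angle → ℂ) (c : ComplexMeasure Angle) : ℂ :=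
  VectorMeasure.integral c f (ContinuousLinearMap.mul ℝ ℂ)

/-- The matrix integral `∫ F dρ G^*`, whose `(i, j)` entry is
`∑ k l, ∫ F i k * conj (G j l) dρ k l`. -/
def MatrixMeasure.integral (ρ : MatrixMeasure p) (F G : Angle → Matrix (Fin p) (Fin p) ℂ) :
    Matrix (Fin p) (Fin p) ℂ :=
  Matrix.of fun i j => ∑ k, ∑ l, cintegral (fun θ => F θ i k * star (G θ j l)) (ρ.entry k l)

/-- The value `P(z) = ∑ k, z ^ k • A k` of the matrix polynomial `P = ∑ k, A k X ^ k` at `z : ℂ`. -/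
def evalAt (P : (Matrix (Fin p) (Fin p) ℂ)[X]) (z : ℂ) : Matrix (Fin p) (Fin p) ℂ :=
  P.sum fun k A => z ^ k • A

/-- The left inner product `⟨P, Q⟩_L = ∫ P(z) dρ(θ) Q(z)^*`, `z = exp (i θ)`. -/
def MatrixMeasure.leftInner (ρ : MatrixMeasure p) (P Q : (Matrix (Fin p) (Fin p) ℂ)[X]) :
    Matrix (Fin p) (Fin p) ℂ :=
  ρ.integral (fun θ => evalAt P (circlePt θ)) (fun θ => evalAt Q (circlePt θ))

/-- `φ` is a sequence of left orthonormal matrix polynomials for `ρ`: `φ n` has degree at most `n`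
and `⟨φ n, φ m⟩_L = δ_{m,n} I`. (The leading coefficients are then automatically nonsingular.) -/
structure IsLeftOrthonormal (ρ : MatrixMeasure p)
    (φ : ℕ → (Matrix (Fin p) (Fin p) ℂ)[X]) : Prop where
  natDegree_le : ∀ n, (φ n).natDegree ≤ n
  inner_eq : ∀ n m, ρ.leftInner (φ n) (φ m) = if n = m then 1 else 0

/-- The density `ρ'` in the Lebesgue decomposition `dρ = ρ' dθ/2π + dρ_s`, taken entrywise. -/
def MatrixMeasure.density (ρ : MatrixMeasure p) (θ : Angle) : Matrix (Fin p) (Fin p) ℂ :=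
  Matrix.of fun k l => (ρ.entry k l).rnDeriv leb θ

section SpectralNorm

open scoped Matrix.Norms.L2Operator

/-- The spectral norm `‖A‖₂` (operator norm for the Euclidean norm). -/
def specNorm (A : Matrix (Fin p) (Fin p) ℂ) : ℝ := ‖A‖

end SpectralNorm

/-- The matrix `φ_n(z) φ_m(z)⁻¹ (φ_m(z)^*)⁻¹ φ_n(z)^* - I` at `z = exp (i θ)`. -/
def ratioDefect (φ : ℕ → (Matrix (Fin p) (Fin p) ℂ)[X]) (n m : ℕ) (θ : Angle) :
    Matrix (Fin p) (Fin p) ℂ :=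
  evalAt (φ n) (circlePt θ) * (evalAt (φ m) (circlePt θ))⁻¹ *
    ((evalAt (φ m) (circlePt θ))ᴴ)⁻¹ * (evalAt (φ n) (circlePt θ))ᴴ - 1

end MatrixOPUC

end

/-! Put W_m = φ_m⁻¹ (φ_m⁻¹)^*, the Bernstein–Szegő weight; the matrix inside the norm is φ_n W_m
φ_n^* - I with m = n + ℓ. The measure W_m dθ/2π has the same moments as ρ up to order m
(`intForm_bsWeight`). Both measures give forms invariant under multiplication by z, and
multiplication by z modulo φ_m has its eigenvalues in the open disc, so iterating it removes every
difference between the two forms. Hence ∫ tr(φ_n W_m φ_n^*) = p for n ≤ m, and W_m dθ/2π → ρ weakly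
(`tendsto_integral_bsWeight`).

Write M for the density of ρ. Weak convergence is tested against a continuous g ≥ 0 that is close to
(M + δ)⁻¹ in Lebesgue mean and to 0 on the singular part (`IsMatrixDensity.exists_test_function`);
then lim ∫ tr(g W_m) = ∫ tr(g dρ) ≤ p + η for any prescribed η > 0.

If det M > 0 almost everywhere, let B_n = φ_n M φ_n^*. Then ∫ tr B_n ≤ p, while tr B_n⁻¹ = tr(M⁻¹
W_n) has integral nearly at most p once M⁻¹ is replaced by g off a small set. Since tr B + tr B⁻¹ ≥
2p with equality only at B = I, B_n → I in measure (`eventually_measure_trace_add_inv_le`).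
Comparing B_n with B_m bounds φ_n W_m φ_n^* below by nearly I off a small set, and the exact mean p
of its trace turns this into convergence in mean.

Conversely, where the defect is below 1/2, W_m is bounded below by a positive matrix depending on n
only, so tr g ≤ const · tr(g W_m). Where det M = 0, tr (M + δ)⁻¹ ≥ 1/δ, which tr g nearly attains.
As ∫ tr(g W_m) stays bounded, that set has small measure when δ → 0 (`measureReal_not_det_pos_le`).
-/

noncomputable section

namespace MatrixOPUC

/-! ### Integration against a complex measure given by a density. -/

section VectorMeasureIntegral

variable {X : Type*} [MeasurableSpace X]

/-- The integral of a bounded measurable function against the complex measure `R dν`. -/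
theorem integral_withDensityᵥ_of_bounded {ν : Measure X} {R : X → ℂ}
    (hR : Integrable R ν) {f : X → ℂ} (hf : Measurable f) {C : ℝ} (hC : ∀ x, ‖f x‖ ≤ C) :
    VectorMeasure.integral (ν.withDensityᵥ R) f (ContinuousLinearMap.mul ℝ ℂ) =
      ∫ x, f x * R x ∂ν := by
  have hvar := Measure.variation_withDensityᵥ hR
  have : IsFiniteMeasure (ν.withDensityᵥ R).variation := by
    rw [hvar]; exact ⟨by simpa using! hR.2⟩
  have hint : ∀ g : X → ℂ, Measurable g → ∀ D : ℝ, (∀ x, ‖g x‖ ≤ D) →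
      (ν.withDensityᵥ R).Integrable g := fun g hg D hD =>
    Integrable.of_bound hg.aestronglyMeasurable D (Eventually.of_forall hD)
  have hint' : ∀ g : X → ℂ, Measurable g → ∀ D : ℝ, (∀ x, ‖g x‖ ≤ D) →
      Integrable (fun x => g x * R x) ν := fun g hg D hD =>
    hR.bdd_mul hg.aestronglyMeasurable (Eventually.of_forall hD)
  have hsimple : ∀ s : SimpleFunc X ℂ,
      VectorMeasure.integral (ν.withDensityᵥ R) s (ContinuousLinearMap.mul ℝ ℂ) =
        ∫ x, s x * R x ∂ν := by
    intro s
    induction s using SimpleFunc.induction with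
    | const c hs =>
      rename_i s
      have h1 : ((SimpleFunc.piecewise s hs (SimpleFunc.const X c) (SimpleFunc.const X 0) :
          SimpleFunc X ℂ) : X → ℂ) = s.indicator (fun _ => c) := by
        ext x; by_cases hx : x ∈ s <;> simp [hx]
      rw [h1, VectorMeasure.integral_indicator hs, VectorMeasure.integral_const]
      have h2 : (fun x => s.indicator (fun _ => c) x * R x) = s.indicator (fun x => c * R x) := by
        ext x; by_cases hx : x ∈ s <;> simp [hx]
      rw [h2, integral_indicator hs, integral_const_mul,
        VectorMeasure.restrict_apply _ hs MeasurableSet.univ, Set.univ_inter,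
        withDensityᵥ_apply hR hs]
      simp
    | add hd hf hg =>
      rename_i f g
      obtain ⟨C1, h1⟩ := f.exists_forall_norm_le
      obtain ⟨C2, h2⟩ := g.exists_forall_norm_le
      rw [SimpleFunc.coe_add, VectorMeasure.integral_add (hint _ f.measurable C1 h1)
        (hint _ g.measurable C2 h2), hf, hg,
        ← integral_add (hint' _ f.measurable C1 h1) (hint' _ g.measurable C2 h2)]
      congr 1; ext x; simp [add_mul]
  have hlim : ∀ x, Tendsto (fun n => (SimpleFunc.approxOn f hf Set.univ 0 (Set.mem_univ _) n) x) atTop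
      (𝓝 (f x)) := fun x => SimpleFunc.tendsto_approxOn hf (Set.mem_univ _) (by simp)
  -- The approximants start from 0, so their norm is at most twice that of `f`; this dominates both
  -- sides of the limit.
  have hbd : ∀ n x, ‖(SimpleFunc.approxOn f hf Set.univ 0 (Set.mem_univ _) n) x‖ ≤ C + C := fun n x =>
    (SimpleFunc.norm_approxOn_zero_le hf (Set.mem_univ _) x n).trans (add_le_add (hC x) (hC x))
  have L1 : Tendsto (fun n => VectorMeasure.integral (ν.withDensityᵥ R)
      (fun x => (SimpleFunc.approxOn f hf Set.univ 0 (Set.mem_univ _) n) x)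
      (ContinuousLinearMap.mul ℝ ℂ)) atTop
      (𝓝 (VectorMeasure.integral (ν.withDensityᵥ R) f (ContinuousLinearMap.mul ℝ ℂ))) :=
    VectorMeasure.tendsto_integral_of_dominated_convergence
    (fun _ => C + C)
    (fun n => (SimpleFunc.measurable _).aestronglyMeasurable) (integrable_const _)
    (fun n => Eventually.of_forall (hbd n)) (Eventually.of_forall hlim)
  have L2 := tendsto_integral_of_dominated_convergence (μ := ν) (f := fun x => f x * R x)
    (F := fun n x => (SimpleFunc.approxOn f hf Set.univ 0 (Set.mem_univ _) n) x * R x)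
    (fun x => (C + C) * ‖R x‖)
    (fun n => (SimpleFunc.measurable _).aestronglyMeasurable.mul hR.1) (hR.norm.const_mul _)
    (fun n => Eventually.of_forall fun x => by
      rw [norm_mul]; exact mul_le_mul_of_nonneg_right (hbd n x) (norm_nonneg _))
    (Eventually.of_forall fun x => (hlim x).mul_const _)
  refine tendsto_nhds_unique L1 (L2.congr fun n => ?_)
  exact (hsimple _).symm

end VectorMeasureIntegral

/-! ### Lebesgue decomposition and a positive semidefinite density. -/

section Decomposition

variable {X : Type*} [MeasurableSpace X]

theorem signedMeasure_eq_singularPart_add (s : SignedMeasure X) (μ : Measure X) [SigmaFinite μ]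
    {B : Set X} (hB : MeasurableSet B) :
    s B = s.singularPart μ B + ∫ x in B, s.rnDeriv μ x ∂μ := by
  conv_lhs => rw [← s.singularPart_add_withDensity_rnDeriv_eq μ]
  rw [_root_.add_apply, withDensityᵥ_apply (SignedMeasure.integrable_rnDeriv _ _) hB]

theorem totalVariation_singularPart_mutuallySingular (s : SignedMeasure X) (μ : Measure X) :
    (s.singularPart μ).totalVariation ⟂ₘ μ := by
  rw [SignedMeasure.singularPart_totalVariation]
  exact (Measure.mutuallySingular_singularPart _ _).add_left
    (Measure.mutuallySingular_singularPart _ _)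

theorem signedMeasure_apply_eq_zero_of_totalVariation {s : SignedMeasure X} {B : Set X}
    (h : s.totalVariation B = 0) : s B = 0 := by
  have := s.enorm_le_totalVariation B
  rw [h] at this
  simpa using this

/-- A signed measure whose singular part is dominated by `σ` has a density with respect to
`μ + σ`, which agrees `μ`-almost everywhere with the density of the absolutely continuous part. -/
theorem signedMeasure_density (s : SignedMeasure X) (μ σ : Measure X) [IsFiniteMeasure μ]
    [IsFiniteMeasure σ] (hσ : (s.singularPart μ).totalVariation ≤ σ) {S : Set X}
    (hS : MeasurableSet S) (hμS : μ S = 0) (hσS : σ Sᶜ = 0) :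
    (∀ B, MeasurableSet B → s B = ∫ x in B, s.rnDeriv (μ + σ) x ∂(μ + σ)) ∧
      s.rnDeriv μ =ᵐ[μ] s.rnDeriv (μ + σ) := by
  have hac : s ≪ᵥ (μ + σ).toENNRealVectorMeasure := by
    apply VectorMeasure.AbsolutelyContinuous.mk
    intro B hB h0
    rw [Measure.toENNRealVectorMeasure_apply_measurable hB, Measure.add_apply, add_eq_zero] at h0
    rw [signedMeasure_eq_singularPart_add s μ hB, Measure.restrict_eq_zero.mpr h0.1,
      signedMeasure_apply_eq_zero_of_totalVariation (le_antisymm ((hσ B).trans h0.2.le) bot_le)]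
    simp
  have key : ∀ B, MeasurableSet B → s B = ∫ x in B, s.rnDeriv (μ + σ) x ∂(μ + σ) := by
    intro B hB
    conv_lhs => rw [← SignedMeasure.withDensityᵥ_rnDeriv_eq s (μ + σ) hac]
    rw [withDensityᵥ_apply (SignedMeasure.integrable_rnDeriv _ _) hB]
  refine ⟨key, ?_⟩
  have hint : Integrable (s.rnDeriv (μ + σ)) μ :=
    (SignedMeasure.integrable_rnDeriv s (μ + σ)).mono_measure (Measure.le_add_right le_rfl)
  refine Integrable.ae_eq_of_forall_setIntegral_eq _ _ (SignedMeasure.integrable_rnDeriv _ _) hint ?_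
  intro B hB _
  -- Off `S` the measure `σ` vanishes, so there both densities integrate to the value of `s`.
  have hSc : ∀ᵐ x ∂μ, x ∈ Sᶜ := by
    rw [ae_iff]; simpa using hμS
  have e1 : (∫ x in B, s.rnDeriv μ x ∂μ) = ∫ x in B ∩ Sᶜ, s.rnDeriv μ x ∂μ :=
    setIntegral_congr_set (eventuallyEq_set.2 (by
      filter_upwards [hSc] with x hx using ⟨fun h => ⟨h, hx⟩, fun h => h.1⟩))
  have e2 : (∫ x in B, s.rnDeriv (μ + σ) x ∂μ) = ∫ x in B ∩ Sᶜ, s.rnDeriv (μ + σ) x ∂μ :=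
    setIntegral_congr_set (eventuallyEq_set.2 (by
      filter_upwards [hSc] with x hx using ⟨fun h => ⟨h, hx⟩, fun h => h.1⟩))
  have hB' := hB.inter hS.compl
  have hσB : σ (B ∩ Sᶜ) = 0 := measure_mono_null Set.inter_subset_right hσS
  have e3 := signedMeasure_eq_singularPart_add s μ hB'
  rw [signedMeasure_apply_eq_zero_of_totalVariation (le_antisymm ((hσ _).trans hσB.le) bot_le),
    zero_add, key _ hB', Measure.restrict_add, Measure.restrict_eq_zero.mpr hσB, add_zero] at e3
  rw [e1, e2, e3]

/-- A matrix function all of whose set integrals are positive semidefinite is positive semidefinite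
almost everywhere. -/
theorem ae_posSemidef_of_setIntegral {p : ℕ} {ν : Measure X}
    {R : X → Matrix (Fin p) (Fin p) ℂ} (hR : ∀ k l, Integrable (fun θ => R θ k l) ν)
    (h : ∀ B, MeasurableSet B → (Matrix.of fun k l => ∫ θ in B, R θ k l ∂ν).PosSemidef) :
    ∀ᵐ θ ∂ν, (R θ).PosSemidef := by
  have hherm : ∀ᵐ θ ∂ν, ∀ k l, star (R θ l k) = R θ k l := by
    refine ae_all_iff.2 fun k => ae_all_iff.2 fun l => ?_
    refine Integrable.ae_eq_of_forall_setIntegral_eq _ _ ?_ (hR k l) fun B hB _ => ?_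
    · exact Complex.conjCLE.toContinuousLinearMap.integrable_comp (hR l k)
    · have := (h B hB).1.apply k l
      simp only [Matrix.of_apply] at this
      rw [← this]
      exact integral_conj
  have hq : ∀ x : Fin p → ℂ, Integrable (fun θ => star x ⬝ᵥ (R θ *ᵥ x)) ν := fun x => by
    simp only [dotProduct, mulVec]
    exact integrable_finsetSum _ fun k _ => (integrable_finsetSum _ fun l _ =>
      (hR k l).mul_const _).const_mul _
  have hqB : ∀ x : Fin p → ℂ, ∀ B, MeasurableSet B → ∫ θ in B, star x ⬝ᵥ (R θ *ᵥ x) ∂ν =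
      star x ⬝ᵥ ((Matrix.of fun k l => ∫ θ in B, R θ k l ∂ν) *ᵥ x) := fun x B hB => by
    simp only [dotProduct, mulVec, Matrix.of_apply]
    rw [integral_finsetSum _ fun k _ => (integrable_finsetSum _ fun l _ =>
      ((hR k l).integrableOn.mul_const _)).const_mul _]
    refine Finset.sum_congr rfl fun k _ => ?_
    rw [integral_const_mul, integral_finsetSum _ fun l _ => ((hR k l).integrableOn.mul_const _)]
    simp_rw [integral_mul_const]
  have hpos : ∀ x : Fin p → ℂ, ∀ᵐ θ ∂ν, 0 ≤ (star x ⬝ᵥ (R θ *ᵥ x)).re := fun x => by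
    refine ae_nonneg_of_forall_setIntegral_nonneg (hq x).re fun B hB _ => ?_
    have h1 := (h B hB).dotProduct_mulVec_nonneg x
    rw [← hqB x B hB] at h1
    have h2 : ∫ θ in B, (star x ⬝ᵥ (R θ *ᵥ x)).re ∂ν = (∫ θ in B, star x ⬝ᵥ (R θ *ᵥ x) ∂ν).re :=
      integral_re (hq x).integrableOn
    exact h2.symm ▸ (Complex.le_def.1 h1).1
  -- The null set depends on the vector; a countable dense family gives a common one, and closedness
  -- of the condition recovers all vectors.
  have hall := ae_all_iff.2 fun n => hpos (TopologicalSpace.denseSeq (Fin p → ℂ) n)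
  filter_upwards [hherm, hall] with θ h1 h2
  have hH : (R θ).IsHermitian := Matrix.IsHermitian.ext fun k l => h1 k l
  refine Matrix.PosSemidef.of_dotProduct_mulVec_nonneg hH fun x => ?_
  rw [Complex.le_def]
  refine ⟨?_, (hH.im_star_dotProduct_mulVec_self x).symm⟩
  have hc : IsClosed {x : Fin p → ℂ | 0 ≤ (star x ⬝ᵥ (R θ *ᵥ x)).re} :=
    isClosed_le continuous_const (by
      simp only [dotProduct, mulVec]
      fun_prop)
  have := hc.closure_subset_iff.2 (Set.range_subset_iff.2 h2)
  exact this (TopologicalSpace.denseRange_denseSeq (Fin p → ℂ) x)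

/-- The matrix measure has a positive semidefinite density with respect to some finite measure
that is the sum of Lebesgue measure and a singular measure. -/
theorem MatrixMeasure.exists_density {p : ℕ} (ρ : MatrixMeasure p) :
    ∃ (ν : Measure Angle) (M : Angle → Matrix (Fin p) (Fin p) ℂ) (S : Set Angle),
      IsFiniteMeasure ν ∧ MeasurableSet S ∧ leb S = 0 ∧ leb = ν.restrict Sᶜ ∧
      (∀ k l, Measurable fun θ => M θ k l) ∧ (∀ k l, Integrable (fun θ => M θ k l) ν) ∧
      (∀ θ, (M θ).PosSemidef) ∧
      (∀ k l, ∀ f : Angle → ℂ, Continuous f →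
        cintegral f (ρ.entry k l) = ∫ θ, f θ * M θ k l ∂ν) ∧
      ρ.density =ᵐ[leb] M := by
  classical
  have hleb : IsFiniteMeasure leb := by unfold leb; infer_instance
  let re' : Fin p × Fin p → SignedMeasure Angle := fun k => (ρ.entry k.1 k.2).re
  let im' : Fin p × Fin p → SignedMeasure Angle := fun k => (ρ.entry k.1 k.2).im
  let τ : Fin p × Fin p → Measure Angle := fun k => ((re' k).singularPart leb).totalVariation +
    ((im' k).singularPart leb).totalVariation
  -- One finite singular measure dominating the singular parts of all real and imaginary entries.
  let σ : Measure Angle := ∑ k, τ k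
  have hfin : ∀ s : SignedMeasure Angle, IsFiniteMeasure s.totalVariation := fun s => by
    unfold SignedMeasure.totalVariation; infer_instance
  have hσfin : IsFiniteMeasure σ := by
    refine ⟨?_⟩
    simp only [σ, Measure.finsetSum_apply]
    exact ENNReal.sum_lt_top.2 fun k _ => measure_lt_top _ _
  have hle : ∀ k, τ k ≤ σ := fun k => Finset.single_le_sum (f := τ)
    (fun _ _ => Measure.zero_le _) (Finset.mem_univ k)
  have hσms : σ ⟂ₘ leb := by
    rw [show σ = Measure.sum τ by simp [σ, Measure.sum_fintype]]
    exact Measure.MutuallySingular.sum_left.2 fun k =>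
      (totalVariation_singularPart_mutuallySingular _ _).add_left
        (totalVariation_singularPart_mutuallySingular _ _)
  obtain ⟨S, hS, hlS, hσS⟩ := hσms.symm
  have hre := fun k => signedMeasure_density (re' k) leb σ
    ((Measure.le_add_right le_rfl).trans (hle k)) hS hlS hσS
  have him := fun k => signedMeasure_density (im' k) leb σ
    ((Measure.le_add_left le_rfl).trans (hle k)) hS hlS hσS
  set ν := leb + σ with hν
  let R : Angle → Matrix (Fin p) (Fin p) ℂ := fun θ => Matrix.of fun k l =>
    (⟨(re' (k, l)).rnDeriv ν θ, (im' (k, l)).rnDeriv ν θ⟩ : ℂ)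
  have hRmeas : ∀ k l, Measurable fun θ => R θ k l := fun k l => by
    have h1 := (re' (k, l)).measurable_rnDeriv ν
    have h2 := (im' (k, l)).measurable_rnDeriv ν
    convert (Complex.measurable_ofReal.comp h1).add
      ((Complex.measurable_ofReal.comp h2).mul_const Complex.I) using 1
    ext θ; exact Complex.mk_eq_add_mul_I _ _
  have hRint : ∀ k l, Integrable (fun θ => R θ k l) ν := fun k l => by
    have h1 := (re' (k, l)).integrable_rnDeriv ν
    have h2 := (im' (k, l)).integrable_rnDeriv ν
    exact (h1.ofReal.add (h2.ofReal.mul_const Complex.I)).congr (Eventually.of_forall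
      fun θ => (Complex.mk_eq_add_mul_I _ _).symm)
  have hRapply : ∀ k l B, MeasurableSet B → ρ.entry k l B = ∫ θ in B, R θ k l ∂ν := by
    intro k l B hB
    have h1 := (hre (k, l)).1 B hB
    have h2 := (him (k, l)).1 B hB
    apply Complex.ext
    · rw [← Complex.reCLM_apply (∫ θ in B, R θ k l ∂ν),
        ← ContinuousLinearMap.integral_comp_comm _ (hRint k l).integrableOn]
      exact h1
    · rw [← Complex.imCLM_apply (∫ θ in B, R θ k l ∂ν),
        ← ContinuousLinearMap.integral_comp_comm _ (hRint k l).integrableOn]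
      exact h2
  have hdens : ρ.density =ᵐ[leb] R := by
    have h1 : ∀ᵐ θ ∂leb, ∀ k, (re' k).rnDeriv leb θ = (re' k).rnDeriv ν θ :=
      ae_all_iff.2 fun k => (hre k).2
    have h2 : ∀ᵐ θ ∂leb, ∀ k, (im' k).rnDeriv leb θ = (im' k).rnDeriv ν θ :=
      ae_all_iff.2 fun k => (him k).2
    filter_upwards [h1, h2] with θ h1 h2
    ext k l
    exact Complex.ext (h1 (k, l)) (h2 (k, l))
  have hRpsd : ∀ᵐ θ ∂ν, (R θ).PosSemidef :=
    ae_posSemidef_of_setIntegral hRint fun B hB => by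
      have := ρ.posSemidef B hB
      simp_rw [hRapply _ _ B hB] at this
      exact this
  have hrestr : leb = ν.restrict Sᶜ := by
    rw [hν, Measure.restrict_add, Measure.restrict_eq_zero.mpr hσS, add_zero]
    refine (Measure.restrict_eq_self_of_ae_mem ?_).symm
    rw [ae_iff]; simpa using hlS
  -- Zeroing the density on a measurable null hull of the bad set makes it positive semidefinite
  -- everywhere and keeps it measurable.
  let Z := toMeasurable ν {θ | ¬ (R θ).PosSemidef}
  have hZ : ∀ᵐ θ ∂ν, θ ∉ Z := by
    rw [ae_iff]; simpa [Z, measure_toMeasurable] using ae_iff.1 hRpsd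
  have hZm : MeasurableSet Z := measurableSet_toMeasurable _ _
  let M : Angle → Matrix (Fin p) (Fin p) ℂ := Zᶜ.indicator R
  have hMR : M =ᵐ[ν] R := by
    filter_upwards [hZ] with θ hθ
    simp [M, hθ]
  have hMR' : ∀ k l, (fun θ => R θ k l) =ᵐ[ν] fun θ => M θ k l := fun k l => by
    filter_upwards [hMR] with θ hθ
    rw [hθ]
  have hνf : IsFiniteMeasure ν := by rw [hν]; infer_instance
  refine ⟨ν, M, S, hνf, hS, hlS, hrestr, ?_, fun k l => (hRint k l).congr (hMR' k l), ?_, ?_, ?_⟩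
  · intro k l
    have : (fun θ => M θ k l) = Zᶜ.indicator fun θ => R θ k l := by
      ext θ; by_cases h : θ ∈ Z <;> simp [M, h]
    rw [this]
    exact (hRmeas k l).indicator hZm.compl
  · intro θ
    by_cases h : θ ∈ Z
    · simpa [M, h] using Matrix.PosSemidef.zero
    · simp only [M, Set.indicator, Set.mem_compl_iff, h, not_false_iff, if_true]
      by_contra h'
      exact h (subset_toMeasurable _ _ h')
  · intro k l f hf
    have hc : ρ.entry k l = ν.withDensityᵥ fun θ => M θ k l := by
      ext B hB
      rw [hRapply k l B hB, withDensityᵥ_apply ((hRint k l).congr (hMR' k l)) hB]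
      exact integral_congr_ae (ae_restrict_of_ae (hMR' k l))
    obtain ⟨C, hC⟩ := isCompact_univ.exists_bound_of_continuousOn hf.continuousOn
    rw [cintegral, hc, integral_withDensityᵥ_of_bounded ((hRint k l).congr (hMR' k l))
      hf.measurable fun x => hC x trivial]
  · have : leb ≪ ν := by rw [hν]; exact Measure.absolutelyContinuous_of_le (Measure.le_add_right le_rfl)
    exact hdens.trans (this.ae_eq hMR.symm)

end Decomposition

/-! ### Inequalities for positive semidefinite matrices, by diagonalization. -/

section MatrixFacts

variable {p : ℕ}

theorem PosSemidef.exists_diagonalization {A : Matrix (Fin p) (Fin p) ℂ} (hA : A.PosSemidef) :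
    ∃ (U : Matrix (Fin p) (Fin p) ℂ) (d : Fin p → ℝ), Uᴴ * U = 1 ∧ U * Uᴴ = 1 ∧
      (∀ i, 0 ≤ d i) ∧ A = U * diagonal (fun i => (d i : ℂ)) * Uᴴ := by
  refine ⟨hA.1.eigenvectorUnitary, hA.1.eigenvalues, ?_, ?_, hA.eigenvalues_nonneg, ?_⟩
  · exact Unitary.coe_star_mul_self hA.1.eigenvectorUnitary
  · exact Unitary.coe_mul_star_self hA.1.eigenvectorUnitary
  · exact hA.1.spectral_theorem

theorem trace_conj_diagonal {U : Matrix (Fin p) (Fin p) ℂ} (hU : Uᴴ * U = 1) (d : Fin p → ℝ) :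
    (U * diagonal (fun i => (d i : ℂ)) * Uᴴ).trace.re = ∑ i, d i := by
  rw [trace_mul_comm, ← Matrix.mul_assoc, hU, Matrix.one_mul, trace_diagonal]
  simp

theorem conj_diagonal_posSemidef (U : Matrix (Fin p) (Fin p) ℂ) {d : Fin p → ℝ}
    (hd : ∀ i, 0 ≤ d i) : (U * diagonal (fun i => (d i : ℂ)) * Uᴴ).PosSemidef :=
  (PosSemidef.diagonal fun i => by simpa using hd i).mul_mul_conjTranspose_same U

theorem smul_one_eq_conj_diagonal {U : Matrix (Fin p) (Fin p) ℂ} (hU : U * Uᴴ = 1) (r : ℝ) :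
    (r : ℂ) • (1 : Matrix (Fin p) (Fin p) ℂ) = U * diagonal (fun _ => (r : ℂ)) * Uᴴ := by
  rw [← smul_one_eq_diagonal, Matrix.mul_smul, Matrix.mul_one, Matrix.smul_mul, hU]

theorem conj_diagonal_inv {U : Matrix (Fin p) (Fin p) ℂ} (hU : Uᴴ * U = 1) (hU' : U * Uᴴ = 1)
    {d : Fin p → ℝ} (hd : ∀ i, d i ≠ 0) :
    (U * diagonal (fun i => (d i : ℂ)) * Uᴴ)⁻¹ =
      U * diagonal (fun i => ((d i)⁻¹ : ℝ) : Fin p → ℂ) * Uᴴ := by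
  refine Matrix.inv_eq_right_inv ?_
  calc _ = U * diagonal (fun i => (d i : ℂ)) * (Uᴴ * U) *
        diagonal (fun i => ((d i)⁻¹ : ℝ) : Fin p → ℂ) * Uᴴ := by simp only [Matrix.mul_assoc]
    _ = 1 := by
      rw [hU, Matrix.mul_one, Matrix.mul_assoc U, diagonal_mul_diagonal]
      have : (fun i => (d i : ℂ) * ((d i)⁻¹ : ℝ)) = fun _ => 1 := by
        ext i
        rw [← Complex.ofReal_mul, mul_inv_cancel₀ (hd i), Complex.ofReal_one]
      rw [this, diagonal_one, Matrix.mul_one, hU']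

theorem trace_re_nonneg {A : Matrix (Fin p) (Fin p) ℂ} (hA : A.PosSemidef) : 0 ≤ A.trace.re :=
  (Complex.le_def.1 hA.trace_nonneg).1

/-- In an eigenbasis of `A` the trace is the sum of the eigenvalues times diagonal entries of the
rotated `B`. -/
theorem trace_mul_re_nonneg {A B : Matrix (Fin p) (Fin p) ℂ} (hA : A.PosSemidef)
    (hB : B.PosSemidef) : 0 ≤ (A * B).trace.re := by
  obtain ⟨U, d, hU, hU', hd, rfl⟩ := PosSemidef.exists_diagonalization hA
  rw [Matrix.mul_assoc, trace_mul_comm, ← Matrix.mul_assoc, trace_mul_comm, trace]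
  have h := hB.conjTranspose_mul_mul_same U
  simp only [diag_apply, diagonal_mul, Complex.re_sum, Complex.re_ofReal_mul]
  exact Finset.sum_nonneg fun i _ => mul_nonneg (hd i) (Complex.le_def.1 (by
    simpa using h.diag_nonneg (i := i))).1

theorem trace_smul_one_sub_posSemidef {A : Matrix (Fin p) (Fin p) ℂ} (hA : A.PosSemidef) :
    ((A.trace.re : ℂ) • (1 : Matrix (Fin p) (Fin p) ℂ) - A).PosSemidef := by
  obtain ⟨U, d, hU, hU', hd, rfl⟩ := PosSemidef.exists_diagonalization hA
  rw [trace_conj_diagonal hU, smul_one_eq_conj_diagonal hU', ← Matrix.sub_mul, ← Matrix.mul_sub,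
    diagonal_sub]
  have := conj_diagonal_posSemidef U (d := fun i => ∑ j, d j - d i) fun i => sub_nonneg.2
    (Finset.single_le_sum (fun j _ => hd j) (Finset.mem_univ i))
  simpa only [Complex.ofReal_sub] using this

theorem trace_mul_re_le {A B : Matrix (Fin p) (Fin p) ℂ} (hA : A.PosSemidef)
    (hB : B.PosSemidef) : (A * B).trace.re ≤ A.trace.re * B.trace.re := by
  have := trace_mul_re_nonneg (trace_smul_one_sub_posSemidef hA) hB
  rw [Matrix.sub_mul, trace_sub, Matrix.smul_mul, Matrix.one_mul, trace_smul, Complex.sub_re,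
    smul_eq_mul, Complex.re_ofReal_mul] at this
  linarith

/-- Expand `A` in an eigenbasis: entries of a unitary matrix have modulus at most 1. -/
theorem norm_apply_le_trace {A : Matrix (Fin p) (Fin p) ℂ} (hA : A.PosSemidef) (k l : Fin p) :
    ‖A k l‖ ≤ A.trace.re := by
  obtain ⟨U, d, hU, hU', hd, rfl⟩ := PosSemidef.exists_diagonalization hA
  have hrow : ∀ k, ∑ i, ‖U k i‖ ^ 2 = 1 := fun k => by
    have h1 : (U * Uᴴ) k k = 1 := by rw [hU', one_apply_eq]
    rw [Matrix.mul_apply] at h1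
    have h2 : ((∑ i, ‖U k i‖ ^ 2 : ℝ) : ℂ) = 1 := by
      rw [← h1, Complex.ofReal_sum]
      exact Finset.sum_congr rfl fun i _ => by
        rw [Complex.ofReal_pow]; exact (Complex.mul_conj' _).symm
    exact_mod_cast h2
  have hle : ∀ k i, ‖U k i‖ ≤ 1 := fun k i => by
    have := Finset.single_le_sum (f := fun i => ‖U k i‖ ^ 2) (fun j _ => by positivity)
      (Finset.mem_univ i)
    rw [hrow] at this
    exact (sq_le_one_iff₀ (norm_nonneg _)).1 this
  rw [trace_conj_diagonal hU, Matrix.mul_apply]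
  refine (norm_sum_le _ _).trans (Finset.sum_le_sum fun i _ => ?_)
  rw [mul_diagonal, conjTranspose_apply, norm_mul, norm_mul, norm_star, Complex.norm_real,
    Real.norm_of_nonneg (hd i)]
  calc ‖U k i‖ * d i * ‖U l i‖ ≤ 1 * d i * 1 :=
        mul_le_mul (mul_le_mul_of_nonneg_right (hle _ _) (hd i)) (hle _ _) (norm_nonneg _)
          (by simpa using hd i)
    _ = d i := by ring

theorem det_conj_diagonal {U : Matrix (Fin p) (Fin p) ℂ} (hU : Uᴴ * U = 1) (d : Fin p → ℝ) :
    (U * diagonal (fun i => (d i : ℂ)) * Uᴴ).det = ∏ i, (d i : ℂ) := by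
  rw [det_mul_comm, ← Matrix.mul_assoc, hU, Matrix.one_mul, det_diagonal]

theorem PosDef.exists_diagonalization {A : Matrix (Fin p) (Fin p) ℂ} (hA : A.PosDef) :
    ∃ (U : Matrix (Fin p) (Fin p) ℂ) (d : Fin p → ℝ), Uᴴ * U = 1 ∧ U * Uᴴ = 1 ∧
      (∀ i, 0 < d i) ∧ A = U * diagonal (fun i => (d i : ℂ)) * Uᴴ := by
  obtain ⟨U, d, hU, hU', hd, rfl⟩ := PosSemidef.exists_diagonalization hA.posSemidef
  refine ⟨U, d, hU, hU', fun i => (hd i).lt_of_ne' fun h => ?_, rfl⟩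
  have := hA.det_pos
  rw [det_conj_diagonal hU, Finset.prod_eq_zero (Finset.mem_univ i) (by rw [h]; rfl)] at this
  exact lt_irrefl _ this

theorem two_le_add_inv {x : ℝ} (hx : 0 < x) : 2 ≤ x + x⁻¹ := by
  have : x + x⁻¹ - 2 = (x - 1) ^ 2 * x⁻¹ := by field_simp; ring
  have h2 : 0 ≤ (x - 1) ^ 2 * x⁻¹ := by positivity
  linarith

theorem two_mul_le_trace_add_inv {B : Matrix (Fin p) (Fin p) ℂ} (hB : B.PosDef) :
    2 * (p : ℝ) ≤ B.trace.re + B⁻¹.trace.re := by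
  obtain ⟨U, d, hU, hU', hd, rfl⟩ := PosDef.exists_diagonalization hB
  rw [conj_diagonal_inv hU hU' fun i => (hd i).ne', trace_conj_diagonal hU,
    trace_conj_diagonal hU, ← Finset.sum_add_distrib]
  calc 2 * (p : ℝ) = ∑ _i : Fin p, (2 : ℝ) := by simp [mul_comm]
    _ ≤ _ := Finset.sum_le_sum fun i _ => two_le_add_inv (hd i)

/-- Quantitative equality case of the trace inequality. Each d + 1/d - 2 is nonnegative, hence at
most ε, so d ≤ 2 + ε and (d - 1)² = (d + 1/d - 2) d ≤ ε (2 + ε). -/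
theorem near_one_of_trace_add_inv {B : Matrix (Fin p) (Fin p) ℂ} (hB : B.PosDef) {ε s : ℝ}
    (hs : 0 ≤ s) (hsε : ε * (2 + ε) ≤ s ^ 2) (h : B.trace.re + B⁻¹.trace.re ≤ 2 * p + ε) :
    (B - ((1 - s : ℝ) : ℂ) • 1).PosSemidef ∧ (((1 + s : ℝ) : ℂ) • 1 - B).PosSemidef := by
  obtain ⟨U, d, hU, hU', hd, rfl⟩ := PosDef.exists_diagonalization hB
  rw [conj_diagonal_inv hU hU' fun i => (hd i).ne', trace_conj_diagonal hU,
    trace_conj_diagonal hU, ← Finset.sum_add_distrib] at h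
  have hi : ∀ i, |d i - 1| ≤ s := fun i => by
    have h1 : ∑ j, (d j + (d j)⁻¹ - 2) ≤ ε := by
      rw [Finset.sum_sub_distrib]
      simp only [Finset.sum_const, Finset.card_univ, Fintype.card_fin, nsmul_eq_mul]
      linarith
    have h2 : d i + (d i)⁻¹ - 2 ≤ ε :=
      (Finset.single_le_sum (f := fun j => d j + (d j)⁻¹ - 2)
        (fun j _ => sub_nonneg.2 (two_le_add_inv (hd j))) (Finset.mem_univ i)).trans h1
    have h3 : d i ≤ 2 + ε := by linarith [inv_pos.2 (hd i)]
    have h4 : (d i - 1) ^ 2 = (d i + (d i)⁻¹ - 2) * d i := by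
      have := (hd i).ne'
      field_simp; ring
    have h0 := sub_nonneg.2 (two_le_add_inv (hd i))
    refine abs_le_of_sq_le_sq ?_ hs
    calc (d i - 1) ^ 2 ≤ ε * (2 + ε) := by
          rw [h4]; exact mul_le_mul h2 h3 (hd i).le (h0.trans h2)
      _ ≤ s ^ 2 := hsε
  constructor
  · rw [smul_one_eq_conj_diagonal hU', ← Matrix.sub_mul, ← Matrix.mul_sub, diagonal_sub]
    have := conj_diagonal_posSemidef U (d := fun i => d i - (1 - s)) fun i => by
      linarith [(abs_le.1 (hi i)).1]
    simpa only [Complex.ofReal_sub] using this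
  · rw [smul_one_eq_conj_diagonal hU', ← Matrix.sub_mul, ← Matrix.mul_sub, diagonal_sub]
    have := conj_diagonal_posSemidef U (d := fun i => (1 + s) - d i) fun i => by
      linarith [(abs_le.1 (hi i)).2]
    simpa only [Complex.ofReal_sub] using this

theorem conj_diagonal_add_smul_inv {U : Matrix (Fin p) (Fin p) ℂ} (hU : Uᴴ * U = 1)
    (hU' : U * Uᴴ = 1) {d : Fin p → ℝ} (hd : ∀ i, 0 ≤ d i) {δ : ℝ} (hδ : 0 < δ) :
    (U * diagonal (fun i => (d i : ℂ)) * Uᴴ + (δ : ℂ) • 1)⁻¹ =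
      U * diagonal (fun i => ((d i + δ)⁻¹ : ℝ) : Fin p → ℂ) * Uᴴ := by
  rw [smul_one_eq_conj_diagonal hU', ← Matrix.add_mul, ← Matrix.mul_add, diagonal_add,
    ← conj_diagonal_inv hU hU' fun i => (add_pos_of_nonneg_of_pos (hd i) hδ).ne']
  simp only [Complex.ofReal_add]

/-- The eigenvalues d/(d + δ) are at most 1, uniformly in δ, even where `A` is singular. -/
theorem trace_inv_add_mul_le {A : Matrix (Fin p) (Fin p) ℂ} (hA : A.PosSemidef) {δ : ℝ}
    (hδ : 0 < δ) : ((A + (δ : ℂ) • 1)⁻¹ * A).trace.re ≤ p := by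
  obtain ⟨U, d, hU, hU', hd, rfl⟩ := PosSemidef.exists_diagonalization hA
  have : U * diagonal (fun i => ((d i + δ)⁻¹ : ℝ) : Fin p → ℂ) * Uᴴ *
      (U * diagonal (fun i => (d i : ℂ)) * Uᴴ) =
      U * diagonal (fun i => ((d i + δ)⁻¹ * d i : ℝ) : Fin p → ℂ) * Uᴴ := by
    calc _ = U * diagonal (fun i => ((d i + δ)⁻¹ : ℝ) : Fin p → ℂ) * (Uᴴ * U) *
          diagonal (fun i => (d i : ℂ)) * Uᴴ := by simp only [Matrix.mul_assoc]
      _ = _ := by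
        rw [hU, Matrix.mul_one, Matrix.mul_assoc U, diagonal_mul_diagonal]
        simp only [Complex.ofReal_mul]
  rw [conj_diagonal_add_smul_inv hU hU' hd hδ, this, trace_conj_diagonal hU]
  calc ∑ i, (d i + δ)⁻¹ * d i ≤ ∑ _i : Fin p, (1 : ℝ) := Finset.sum_le_sum fun i _ => by
        rw [inv_mul_le_one₀ (add_pos_of_nonneg_of_pos (hd i) hδ)]
        linarith
    _ = p := by simp

theorem inv_add_posSemidef {A : Matrix (Fin p) (Fin p) ℂ} (hA : A.PosSemidef) {δ : ℝ}
    (hδ : 0 < δ) : ((A + (δ : ℂ) • 1)⁻¹).PosSemidef := by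
  obtain ⟨U, d, hU, hU', hd, rfl⟩ := PosSemidef.exists_diagonalization hA
  rw [conj_diagonal_add_smul_inv hU hU' hd hδ]
  exact conj_diagonal_posSemidef U fun i => inv_nonneg.2 (add_pos_of_nonneg_of_pos (hd i) hδ).le

theorem trace_inv_add_le {A : Matrix (Fin p) (Fin p) ℂ} (hA : A.PosSemidef) {δ : ℝ}
    (hδ : 0 < δ) : ((A + (δ : ℂ) • 1)⁻¹).trace.re ≤ p * δ⁻¹ := by
  obtain ⟨U, d, hU, hU', hd, rfl⟩ := PosSemidef.exists_diagonalization hA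
  rw [conj_diagonal_add_smul_inv hU hU' hd hδ, trace_conj_diagonal hU]
  calc ∑ i, (d i + δ)⁻¹ ≤ ∑ _i : Fin p, δ⁻¹ := Finset.sum_le_sum fun i _ =>
        inv_anti₀ hδ (by linarith [hd i])
    _ = p * δ⁻¹ := by simp

/-- A zero eigenvalue alone contributes δ⁻¹; this blow-up detects singular points of the density. -/
theorem inv_le_trace_inv_add {A : Matrix (Fin p) (Fin p) ℂ} (hA : A.PosSemidef) {δ : ℝ}
    (hδ : 0 < δ) (hdet : A.det = 0) : δ⁻¹ ≤ ((A + (δ : ℂ) • 1)⁻¹).trace.re := by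
  obtain ⟨U, d, hU, hU', hd, rfl⟩ := PosSemidef.exists_diagonalization hA
  rw [det_conj_diagonal hU, Finset.prod_eq_zero_iff] at hdet
  obtain ⟨i, -, hi⟩ := hdet
  rw [Complex.ofReal_eq_zero] at hi
  rw [conj_diagonal_add_smul_inv hU hU' hd hδ, trace_conj_diagonal hU]
  refine le_trans (by rw [hi, zero_add]) (Finset.single_le_sum (f := fun i => (d i + δ)⁻¹)
    (fun j _ => inv_nonneg.2 (add_pos_of_nonneg_of_pos (hd j) hδ).le) (Finset.mem_univ i))

theorem algebraMap_real_eq (r : ℝ) :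
    algebraMap ℝ (Matrix (Fin p) (Fin p) ℂ) r = (r : ℂ) • 1 := by
  rw [Algebra.algebraMap_eq_smul_one]
  ext i j
  simp

open scoped Matrix.Norms.L2Operator MatrixOrder in
theorem specNorm_le_trace {A : Matrix (Fin p) (Fin p) ℂ} (hA : A.PosSemidef) :
    specNorm A ≤ A.trace.re := by
  unfold specNorm
  rw [CStarAlgebra.norm_le_iff_le_algebraMap A (trace_re_nonneg hA) hA.nonneg]
  rw [Matrix.le_iff]
  rw [algebraMap_real_eq]
  exact trace_smul_one_sub_posSemidef hA

open scoped Matrix.Norms.L2Operator MatrixOrder in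
theorem sub_half_posSemidef {A : Matrix (Fin p) (Fin p) ℂ} (hA : A.IsHermitian)
    (h : specNorm (A - 1) ≤ 1 / 2) : (A - ((1 / 2 : ℝ) : ℂ) • 1).PosSemidef := by
  have hH : (A - 1).IsHermitian := hA.sub isHermitian_one
  have h1 := IsSelfAdjoint.neg_algebraMap_norm_le_self (a := A - 1) hH
  rw [algebraMap_real_eq, Matrix.le_iff] at h1
  have h2 : (((1 / 2 - specNorm (A - 1) : ℝ) : ℂ) •
      (1 : Matrix (Fin p) (Fin p) ℂ)).PosSemidef :=
    PosSemidef.one.smul (by rw [Complex.zero_le_real]; linarith)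
  have h3 : A - ((1 / 2 : ℝ) : ℂ) • 1 = (A - 1 - -((specNorm (A - 1) : ℂ) • 1)) +
      ((1 / 2 - specNorm (A - 1) : ℝ) : ℂ) • 1 := by
    ext i j
    simp only [Matrix.sub_apply, Matrix.add_apply, Matrix.neg_apply, Matrix.smul_apply,
      smul_eq_mul]
    push_cast
    ring
  rw [h3]
  exact h1.add h2

open scoped Matrix.Norms.L2Operator in
-- Write A - 1 = (A - r) - (1 - r) and bound the norm of the positive part by its trace. The bound
-- is affine in the trace, so it can be integrated exactly.
theorem specNorm_sub_one_le {A : Matrix (Fin p) (Fin p) ℂ} {r : ℝ} (hr : r ≤ 1)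
    (hA : (A - (r : ℂ) • 1).PosSemidef) :
    specNorm (A - 1) ≤ A.trace.re - r * p + (1 - r) := by
  have h1 := specNorm_le_trace hA
  have h2 : (A - (r : ℂ) • 1).trace.re = A.trace.re - r * p := by
    simp [trace_sub, trace_smul]
  have h3 : specNorm ((((1 - r : ℝ) : ℂ)) • (1 : Matrix (Fin p) (Fin p) ℂ)) ≤ 1 - r := by
    unfold specNorm
    rw [norm_smul, Complex.norm_real, Real.norm_of_nonneg (sub_nonneg.2 hr)]
    have h4 : ‖(1 : Matrix (Fin p) (Fin p) ℂ)‖ ≤ 1 := by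
      rcases subsingleton_or_nontrivial (Matrix (Fin p) (Fin p) ℂ) with h | h
      · rw [Subsingleton.elim (1 : Matrix (Fin p) (Fin p) ℂ) 0, norm_zero]; exact zero_le_one
      · exact (CStarRing.norm_one).le
    exact mul_le_of_le_one_right (sub_nonneg.2 hr) h4
  calc specNorm (A - 1) = specNorm ((A - (r : ℂ) • 1) - ((1 - r : ℝ) : ℂ) • 1) := by
        congr 1
        push_cast
        rw [sub_smul, one_smul]
        abel
    _ ≤ specNorm (A - (r : ℂ) • 1) +
        specNorm ((((1 - r : ℝ) : ℂ)) • (1 : Matrix (Fin p) (Fin p) ℂ)) := norm_sub_le _ _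
    _ ≤ _ := by rw [h2] at h1; linarith

/-- The second bound says M ≤ (1 + s) Q⁻¹Q⁻¹ᴴ. Conjugating by `P` gives (1 + s) P Q⁻¹Q⁻¹ᴴ Pᴴ ≥ P M
Pᴴ ≥ 1 - s, so `M` drops out. -/
theorem sub_smul_posSemidef_of_near {P Q M : Matrix (Fin p) (Fin p) ℂ} (hQ : IsUnit Q.det)
    {s : ℝ} (hs : 0 ≤ s) (h1 : (P * M * Pᴴ - ((1 - s : ℝ) : ℂ) • 1).PosSemidef)
    (h2 : (((1 + s : ℝ) : ℂ) • 1 - Q * M * Qᴴ).PosSemidef) :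
    (P * (Q⁻¹ * Q⁻¹ᴴ) * Pᴴ - (((1 - s) / (1 + s) : ℝ) : ℂ) • 1).PosSemidef := by
  have h3 := h2.mul_mul_conjTranspose_same (P * Q⁻¹)
  have h4 : P * Q⁻¹ * (((1 + s : ℝ) : ℂ) • 1 - Q * M * Qᴴ) * (P * Q⁻¹)ᴴ =
      ((1 + s : ℝ) : ℂ) • (P * (Q⁻¹ * Q⁻¹ᴴ) * Pᴴ) - P * M * Pᴴ := by
    have h5 : Q⁻¹ * Q = 1 := nonsing_inv_mul Q hQ
    have h6 : Qᴴ * Q⁻¹ᴴ = 1 := by rw [← conjTranspose_mul, h5, conjTranspose_one]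
    rw [Matrix.mul_sub, Matrix.sub_mul, conjTranspose_mul]
    congr 1
    · simp only [Matrix.mul_smul, Matrix.smul_mul, Matrix.mul_one, Matrix.mul_assoc]
    · calc _ = P * (Q⁻¹ * Q) * M * (Qᴴ * Q⁻¹ᴴ) * Pᴴ := by simp only [Matrix.mul_assoc]
        _ = _ := by rw [h5, h6, Matrix.mul_one, Matrix.mul_one]
  have h7 := (h1.add (h4 ▸ h3)).smul (a := (((1 + s)⁻¹ : ℝ) : ℂ)) (by
    rw [Complex.zero_le_real]; positivity)
  convert h7 using 1
  have h8 : ((1 + s : ℝ) : ℂ) ≠ 0 := by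
    rw [Complex.ofReal_ne_zero]; positivity
  ext i j
  simp only [Matrix.sub_apply, Matrix.add_apply, Matrix.smul_apply, smul_eq_mul]
  push_cast at h8 ⊢
  field_simp
  ring

end MatrixFacts

/-! ### Powers of operators with spectrum in the open unit disc. -/

section PowersTendToZero

open scoped Matrix.Norms.L2Operator in
-- Gelfand's formula: the spectral radius is below some r < 1, so the norm of the N-th power is
-- eventually at most r^N.
theorem matrix_pow_tendsto_zero {n : ℕ} (A : Matrix (Fin n) (Fin n) ℂ)
    (h : ∀ z ∈ spectrum ℂ A, ‖z‖ < 1) : Tendsto (fun N => A ^ N) atTop (𝓝 0) := by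
  rcases subsingleton_or_nontrivial (Matrix (Fin n) (Fin n) ℂ) with hs | hs
  · exact tendsto_const_nhds.congr fun N => Subsingleton.elim _ _
  have h1 : spectralRadius ℂ A < (1 : NNReal) :=
    spectrum.spectralRadius_lt_of_forall_lt A fun z hz => by exact_mod_cast h z hz
  obtain ⟨r, hr1, hr2⟩ := ENNReal.lt_iff_exists_nnreal_btwn.1 h1
  have h2 := (spectrum.pow_nnnorm_pow_one_div_tendsto_nhds_spectralRadius A).eventually_lt_const hr1
  have hr : r < 1 := by exact_mod_cast hr2
  refine squeeze_zero_norm' (a := fun N => (r : ℝ) ^ N) ?_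
    (tendsto_pow_atTop_nhds_zero_of_lt_one r.2 (by exact_mod_cast hr))
  filter_upwards [h2, eventually_gt_atTop 0] with N hN hN0
  have h3 : (‖A ^ N‖₊ : ENNReal) ≤ (r : ENNReal) ^ N := by
    have := ENNReal.rpow_le_rpow hN.le (z := N) (by positivity)
    rwa [← ENNReal.rpow_mul, one_div_mul_cancel (by positivity), ENNReal.rpow_one,
      ENNReal.rpow_natCast] at this
  exact_mod_cast h3

/-- An endomorphism of a finite-dimensional space with all eigenvalues in the open unit disc has
powers tending to zero, coordinatewise. -/
theorem repr_pow_tendsto_zero {V : Type*} [AddCommGroup V] [Module ℂ V] [FiniteDimensional ℂ V]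
    (T : Module.End ℂ V) (h : ∀ z, T.HasEigenvalue z → ‖z‖ < 1) (u : V) (i) :
    Tendsto (fun N => (Module.finBasis ℂ V).repr ((T ^ N) u) i) atTop (𝓝 0) := by
  set b := Module.finBasis ℂ V
  have hA := matrix_pow_tendsto_zero (LinearMap.toMatrixAlgEquiv b T) fun z hz => by
    rw [AlgEquiv.spectrum_eq] at hz
    exact h z (Module.End.hasEigenvalue_iff_mem_spectrum.2 hz)
  have h1 : ∀ N, b.repr ((T ^ N) u) i =
      ((LinearMap.toMatrixAlgEquiv b T) ^ N *ᵥ (b.repr u)) i := fun N => by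
    rw [← map_pow]
    exact (congrFun (LinearMap.toMatrix_mulVec_repr b b (T ^ N) u) i).symm
  have hc : Continuous fun A : Matrix (Fin (Module.finrank ℂ V)) (Fin (Module.finrank ℂ V)) ℂ =>
      (A *ᵥ (b.repr u)) i := by
    fun_prop
  have h2 := (hc.tendsto 0).comp hA
  rw [zero_mulVec] at h2
  exact h2.congr fun N => (h1 N).symm

end PowersTendToZero

/-! ### Row vectors of polynomials and division by a matrix polynomial. -/

section PolyVec

variable {p : ℕ}

/-- Row vectors of complex polynomials. -/
abbrev PolyVec (p : ℕ) := Fin p → ℂ[X]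

/-- Row vectors of polynomials of degree less than `n`. -/
def degLT (p n : ℕ) : Submodule ℂ (PolyVec p) where
  carrier := {u | ∀ k, ∀ j, n ≤ j → (u k).coeff j = 0}
  add_mem' hu hv k j hj := by simp [hu k j hj, hv k j hj]
  zero_mem' k j _ := by simp
  smul_mem' c u hu k j hj := by simp [hu k j hj]

theorem degLT_mono {m n : ℕ} (h : m ≤ n) : degLT p m ≤ degLT p n :=
  fun _ hu k j hj => hu k j (h.trans hj)

theorem degLT_zero {u : PolyVec p} (hu : u ∈ degLT p 0) : u = 0 := by
  ext k j
  simpa using hu k j (Nat.zero_le _)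

theorem X_smul_mem_degLT {n : ℕ} {u : PolyVec p} (hu : u ∈ degLT p n) :
    (X : ℂ[X]) • u ∈ degLT p (n + 1) := by
  intro k j hj
  obtain ⟨j, rfl⟩ := Nat.exists_eq_add_of_le' (le_trans (Nat.le_add_left 1 n) hj)
  simp only [Pi.smul_apply, smul_eq_mul, coeff_X_mul]
  exact hu k j (by omega)

/-- The row vector polynomial `c P` for a constant row vector `c` and a matrix polynomial `P`. -/
def vecMulPoly (P : (Matrix (Fin p) (Fin p) ℂ)[X]) : (Fin p → ℂ) →ₗ[ℂ] PolyVec p where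
  toFun c k := ∑ i, c i • matPolyEquiv.symm P i k
  map_add' c d := by ext k; simp [add_mul, Finset.sum_add_distrib]
  map_smul' a c := by ext k; simp [Finset.mul_sum, mul_assoc]

theorem coeff_vecMulPoly (P : (Matrix (Fin p) (Fin p) ℂ)[X]) (c : Fin p → ℂ) (k : Fin p) (j : ℕ) :
    (vecMulPoly P c k).coeff j = (c ᵥ* P.coeff j) k := by
  simp [vecMulPoly, vecMul, dotProduct, matPolyEquiv_symm_apply_coeff]

theorem vecMulPoly_mem_degLT {P : (Matrix (Fin p) (Fin p) ℂ)[X]} {n : ℕ} (hP : P.natDegree ≤ n)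
    (c : Fin p → ℂ) : vecMulPoly P c ∈ degLT p (n + 1) := by
  intro k j hj
  rw [coeff_vecMulPoly, coeff_eq_zero_of_natDegree_lt (by omega)]
  simp

theorem vecMulPoly_eq_sum (P : (Matrix (Fin p) (Fin p) ℂ)[X]) (c : Fin p → ℂ) :
    vecMulPoly P c = ∑ i, c i • vecMulPoly P (Pi.single i 1) := by
  conv_lhs => rw [pi_eq_sum_univ' c]
  simp [map_sum]

/-- The vector of coefficients of `X ^ n`. -/
def coeffVec (n : ℕ) : PolyVec p →ₗ[ℂ] (Fin p → ℂ) where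
  toFun u k := (u k).coeff n
  map_add' u v := by ext k; simp
  map_smul' a u := by ext k; simp

/-- The constant row vector `c` such that `u - c P` has lower degree than `P`. -/
def quotVec (P : (Matrix (Fin p) (Fin p) ℂ)[X]) (n : ℕ) : PolyVec p →ₗ[ℂ] (Fin p → ℂ) :=
  (Matrix.vecMulLinear ((P.coeff n)⁻¹)) ∘ₗ coeffVec n

theorem sub_vecMulPoly_mem_degLT {P : (Matrix (Fin p) (Fin p) ℂ)[X]} {n : ℕ}
    (hP : P.natDegree ≤ n) (hκ : IsUnit (P.coeff n).det) {u : PolyVec p}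
    (hu : u ∈ degLT p (n + 1)) : u - vecMulPoly P (quotVec P n u) ∈ degLT p n := by
  intro k j hj
  rcases hj.eq_or_lt with rfl | hj
  · simp only [Pi.sub_apply, coeff_sub, coeff_vecMulPoly, quotVec, LinearMap.comp_apply,
      vecMulLinear_apply, vecMul_vecMul, nonsing_inv_mul _ hκ, vecMul_one]
    simp [coeffVec]
  · rw [Pi.sub_apply, coeff_sub, hu k j hj, vecMulPoly_mem_degLT hP _ k j hj, sub_zero]

/-- Multiplication by `X` modulo the matrix polynomial `P` of degree `n`. -/
def mulXMod (P : (Matrix (Fin p) (Fin p) ℂ)[X]) (n : ℕ) (hP : P.natDegree ≤ n)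
    (hκ : IsUnit (P.coeff n).det) : Module.End ℂ (degLT p n) where
  toFun u := ⟨(X : ℂ[X]) • (u : PolyVec p) - vecMulPoly P (quotVec P n ((X : ℂ[X]) • u)),
    sub_vecMulPoly_mem_degLT hP hκ (X_smul_mem_degLT u.2)⟩
  map_add' u v := by
    ext1
    simp only [Submodule.coe_add, smul_add, map_add]
    abel
  map_smul' a u := by
    ext1
    simp only [Submodule.coe_smul, RingHom.id_apply, smul_comm (X : ℂ[X]) a, map_smul, smul_sub]

theorem X_smul_eq (P : (Matrix (Fin p) (Fin p) ℂ)[X]) (n : ℕ) (hP : P.natDegree ≤ n)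
    (hκ : IsUnit (P.coeff n).det) (u : degLT p n) :
    (X : ℂ[X]) • (u : PolyVec p) =
      vecMulPoly P (quotVec P n ((X : ℂ[X]) • (u : PolyVec p))) + (mulXMod P n hP hκ u : PolyVec p) := by
  simp [mulXMod]

end PolyVec

/-! ### Shift-invariant forms and their orthonormal polynomials. -/

section ShiftForm

variable {p : ℕ}

instance finiteDimensional_degLT (n : ℕ) : FiniteDimensional ℂ (degLT p n) := by
  let f : degLT p n →ₗ[ℂ] (Fin p → Fin n → ℂ) :=
    { toFun := fun u k j => ((u : PolyVec p) k).coeff j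
      map_add' := fun u v => by ext; simp
      map_smul' := fun a u => by ext; simp }
  refine Module.Finite.of_injective f fun u v h => ?_
  ext k j
  rcases lt_or_ge j n with hj | hj
  · exact congrFun (congrFun h k) ⟨j, hj⟩
  · rw [u.2 k j hj, v.2 k j hj]

/-- A positive semidefinite Hermitian form on row vectors of polynomials which is invariant under
multiplication by `X`. -/
structure IsShiftForm (F : PolyVec p →ₗ[ℂ] PolyVec p →ₗ⋆[ℂ] ℂ) : Prop where
  shift : ∀ u v, F ((X : ℂ[X]) • u) ((X : ℂ[X]) • v) = F u v
  nonneg : ∀ u, 0 ≤ F u u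
  symm : ∀ u v, F v u = star (F u v)

/-- The rows of the matrix polynomials `φ n`, of degree at most `n`, are orthonormal. -/
structure IsOrthonormalFor (F : PolyVec p →ₗ[ℂ] PolyVec p →ₗ⋆[ℂ] ℂ)
    (φ : ℕ → (Matrix (Fin p) (Fin p) ℂ)[X]) : Prop where
  natDegree_le : ∀ n, (φ n).natDegree ≤ n
  inner_eq : ∀ n m c d, F (vecMulPoly (φ n) c) (vecMulPoly (φ m) d) =
    if n = m then c ⬝ᵥ star d else 0

theorem eq_zero_of_dotProduct_star {c : Fin p → ℂ} (h : c ⬝ᵥ star c = 0) : c = 0 :=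
  dotProduct_self_star_eq_zero.1 h

variable {F : PolyVec p →ₗ[ℂ] PolyVec p →ₗ⋆[ℂ] ℂ} {φ : ℕ → (Matrix (Fin p) (Fin p) ℂ)[X]}

/-- If v ≠ 0 kills the leading coefficient, then v φ_n has degree below n and is orthogonal to
itself, although its square norm is v v^* ≠ 0. -/
theorem isUnit_det_coeff_of_orthogonal (hφ : IsOrthonormalFor F φ) (n : ℕ)
    (h : ∀ u ∈ degLT p n, ∀ c, F u (vecMulPoly (φ n) c) = 0) : IsUnit ((φ n).coeff n).det := by
  rw [isUnit_iff_ne_zero]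
  intro h0
  obtain ⟨v, hv, hv0⟩ := exists_vecMul_eq_zero_iff.2 h0
  refine hv (eq_zero_of_dotProduct_star ?_)
  have h1 := hφ.inner_eq n n v v
  rw [if_pos rfl] at h1
  rw [← h1]
  refine h _ (fun k j hj => ?_) _
  rcases hj.eq_or_lt with rfl | hj
  · rw [coeff_vecMulPoly, hv0]; rfl
  · exact vecMulPoly_mem_degLT (hφ.natDegree_le n) v k j hj

/-- Orthogonality at level n makes the leading coefficient of φ_n invertible, so a vector of degree
at most n is c φ_n plus a vector of lower degree; this splitting carries both claims to level n + 1.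
-/
theorem orthogonal_and_definite (hF : IsShiftForm F) (hφ : IsOrthonormalFor F φ) (n : ℕ) :
    (∀ u ∈ degLT p n, ∀ m ≥ n, ∀ c, F u (vecMulPoly (φ m) c) = 0) ∧
      ∀ u ∈ degLT p n, F u u = 0 → u = 0 := by
  induction n with
  | zero =>
    refine ⟨fun u hu m _ c => ?_, fun u hu _ => degLT_zero hu⟩
    rw [degLT_zero hu]; simp
  | succ n ih =>
    have hκ := isUnit_det_coeff_of_orthogonal hφ n fun u hu c => ih.1 u hu n le_rfl c
    have key : ∀ u ∈ degLT p (n + 1), ∃ c, ∃ w ∈ degLT p n, u = vecMulPoly (φ n) c + w :=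
      fun u hu => ⟨_, _, sub_vecMulPoly_mem_degLT (hφ.natDegree_le n) hκ hu, by abel⟩
    refine ⟨fun u hu m hm c => ?_, fun u hu h0 => ?_⟩
    · obtain ⟨a, w, hw, rfl⟩ := key u hu
      rw [map_add, LinearMap.add_apply, hφ.inner_eq, if_neg (by omega), zero_add]
      exact ih.1 w hw m (by omega) c
    · obtain ⟨a, w, hw, rfl⟩ := key u hu
      have h1 : F w (vecMulPoly (φ n) a) = 0 := ih.1 w hw n le_rfl a
      have h2 : F (vecMulPoly (φ n) a) w = 0 := by rw [hF.symm w, h1, star_zero]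
      simp only [map_add, LinearMap.add_apply, h1, h2, hφ.inner_eq, if_true, add_zero,
        zero_add] at h0
      have h3 := (add_eq_zero_iff_of_nonneg (dotProduct_self_star_nonneg a) (hF.nonneg w)).1 h0
      rw [eq_zero_of_dotProduct_star h3.1, ih.2 w hw h3.2]
      simp

theorem IsOrthonormalFor.isUnit_det_coeff (hF : IsShiftForm F) (hφ : IsOrthonormalFor F φ)
    (n : ℕ) : IsUnit ((φ n).coeff n).det :=
  isUnit_det_coeff_of_orthogonal hφ n fun u hu c =>
    (orthogonal_and_definite hF hφ n).1 u hu n le_rfl c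

/-- Pythagoras at a single level n. Only data for this n are assumed, so that it also applies to the
Bernstein–Szegő form. -/
theorem form_vecMulPoly_add {n : ℕ} (hF : IsShiftForm F)
    (h1 : ∀ c d, F (vecMulPoly (φ n) c) (vecMulPoly (φ n) d) = c ⬝ᵥ star d)
    (h2 : ∀ u ∈ degLT p n, ∀ c, F u (vecMulPoly (φ n) c) = 0) {u v : PolyVec p}
    (hu : u ∈ degLT p n) (hv : v ∈ degLT p n) (a b : Fin p → ℂ) :
    F (vecMulPoly (φ n) a + u) (vecMulPoly (φ n) b + v) = a ⬝ᵥ star b + F u v := by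
  have h3 : F (vecMulPoly (φ n) a) v = 0 := by rw [hF.symm v, h2 v hv, star_zero]
  simp only [map_add, LinearMap.add_apply, h1, h2 u hu, h3, add_zero, zero_add]

theorem IsOrthonormalFor.form_add (hF : IsShiftForm F) (hφ : IsOrthonormalFor F φ) {n : ℕ}
    {u v : PolyVec p} (hu : u ∈ degLT p n) (hv : v ∈ degLT p n) (a b : Fin p → ℂ) :
    F (vecMulPoly (φ n) a + u) (vecMulPoly (φ n) b + v) = a ⬝ᵥ star b + F u v :=
  form_vecMulPoly_add hF (fun c d => by rw [hφ.inner_eq, if_pos rfl])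
    (fun u hu c => (orthogonal_and_definite hF hφ n).1 u hu n le_rfl c) hu hv a b

/-- If `X u = a φ + z u` with `u ≠ 0` of degree less than that of `φ`, then `|z| < 1`. -/
theorem norm_lt_one_of_X_smul_eq (hF : IsShiftForm F) (hφ : IsOrthonormalFor F φ) {n : ℕ}
    {u : PolyVec p} (hu : u ∈ degLT p n) (hu0 : u ≠ 0) {a : Fin p → ℂ} {z : ℂ}
    (h : (X : ℂ[X]) • u = vecMulPoly (φ n) a + z • u) : ‖z‖ < 1 := by
  have h1 := hF.shift u u
  rw [h, hφ.form_add hF ((degLT p n).smul_mem z hu) ((degLT p n).smul_mem z hu)] at h1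
  simp only [map_smul, LinearMap.smul_apply, LinearMap.map_smulₛₗ, smul_eq_mul] at h1
  have h2 : 0 ≤ F u u := hF.nonneg u
  have h3 : F u u ≠ 0 := fun h => hu0 ((orthogonal_and_definite hF hφ n).2 u hu h)
  have h4 : 0 ≤ a ⬝ᵥ star a := dotProduct_self_star_nonneg a
  have h5 : (starRingEnd ℂ) z * (z * F u u) = ((‖z‖ ^ 2 : ℝ) : ℂ) * F u u := by
    rw [← mul_assoc, Complex.conj_mul']; push_cast; ring
  rw [h5] at h1
  have h6 := congrArg Complex.re h1
  rw [Complex.add_re, Complex.re_ofReal_mul] at h6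
  have h7 : 0 < (F u u).re := (Complex.lt_def.1 (lt_of_le_of_ne h2 h3.symm)).1
  have h8 : 0 ≤ (a ⬝ᵥ star a).re := (Complex.le_def.1 h4).1
  -- Shift invariance reads F(u,u) = a a^* + |z|² F(u,u) with F(u,u) > 0. If |z| ≥ 1 then a = 0, and
  -- (X - z) u = 0 forces u = 0.
  by_contra hz
  rw [not_lt] at hz
  have h9 : 1 ≤ ‖z‖ ^ 2 := one_le_pow₀ hz
  have h10 : (a ⬝ᵥ star a).re = 0 := by nlinarith
  have h11 : a = 0 := eq_zero_of_dotProduct_star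
    (Complex.ext h10 (Complex.le_def.1 h4).2.symm)
  rw [h11, map_zero, zero_add] at h
  apply hu0
  ext1 k
  have h12 : (X - C z) * u k = 0 := by
    have := congrFun h k
    simp only [Pi.smul_apply, smul_eq_mul, smul_eq_C_mul] at this
    rw [sub_mul, this, sub_self]
  exact (mul_eq_zero.1 h12).resolve_left (X_sub_C_ne_zero z)

theorem eval_vecMulPoly (P : (Matrix (Fin p) (Fin p) ℂ)[X]) (c : Fin p → ℂ) (z : ℂ) (k : Fin p) :
    (vecMulPoly P c k).eval z = (c ᵥ* (matPolyEquiv.symm P).map (Polynomial.eval z)) k := by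
  simp [vecMulPoly, vecMul, dotProduct, eval_finsetSum]

/-- If v φ_n vanishes at z, the quotient q = v φ_n / (X - z) satisfies X q = v φ_n + z q, which
forces |z| < 1. -/
theorem IsOrthonormalFor.det_eval_ne_zero (hF : IsShiftForm F) (hφ : IsOrthonormalFor F φ) (n : ℕ)
    {z : ℂ} (hz : ‖z‖ = 1) : ((matPolyEquiv.symm (φ n)).map (Polynomial.eval z)).det ≠ 0 := by
  intro h0
  obtain ⟨v, hv, hv0⟩ := exists_vecMul_eq_zero_iff.2 h0
  let q : PolyVec p := fun k => vecMulPoly (φ n) v k /ₘ (X - C z)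
  have hq : q ∈ degLT p n := fun k j hj => by
    simp only [q]
    rw [coeff_divByMonic_X_sub_C]
    refine Finset.sum_eq_zero fun i hi => ?_
    rw [vecMulPoly_mem_degLT (hφ.natDegree_le n) v k i (by
      have := (Finset.mem_Icc.1 hi).1; omega), mul_zero]
  have h1 : (X : ℂ[X]) • q = vecMulPoly (φ n) v + z • q := by
    ext1 k
    have h2 : (X - C z) * q k = vecMulPoly (φ n) v k :=
      mul_divByMonic_eq_iff_isRoot.2 (by rw [IsRoot, eval_vecMulPoly, hv0]; rfl)
    rw [Pi.add_apply, ← h2, Pi.smul_apply, Pi.smul_apply, smul_eq_mul, smul_eq_C_mul]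
    ring
  have hq0 : q ≠ 0 := fun hq0 => by
    rw [hq0, smul_zero, smul_zero, add_zero] at h1
    have h2 := hφ.inner_eq n n v v
    rw [← h1, if_pos rfl] at h2
    simp only [map_zero] at h2
    exact hv (eq_zero_of_dotProduct_star h2.symm)
  exact (norm_lt_one_of_X_smul_eq hF hφ hq hq0 h1).ne hz

/-- An eigenvector w of multiplication by `X` modulo φ_n satisfies X w = a φ_n + z w, so every
eigenvalue lies in the open disc. -/
theorem IsOrthonormalFor.repr_mulXMod_pow_tendsto_zero (hF : IsShiftForm F)
    (hφ : IsOrthonormalFor F φ) (n : ℕ) (u : degLT p n) (i) :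
    Tendsto (fun N => (Module.finBasis ℂ (degLT p n)).repr
      ((mulXMod (φ n) n (hφ.natDegree_le n) (hφ.isUnit_det_coeff hF n) ^ N) u) i) atTop (𝓝 0) := by
  refine repr_pow_tendsto_zero _ (fun z hz => ?_) u i
  obtain ⟨w, hw⟩ := hz.exists_hasEigenvector
  have h1 := X_smul_eq (φ n) n (hφ.natDegree_le n) (hφ.isUnit_det_coeff hF n) w
  rw [hw.apply_eq_smul] at h1
  exact norm_lt_one_of_X_smul_eq hF hφ w.2 (by simpa using hw.2) h1

variable {G : PolyVec p →ₗ[ℂ] PolyVec p →ₗ⋆[ℂ] ℂ}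

/-- Two shift-invariant forms agree on polynomials of degree at most `n` if they share the
orthonormal polynomial of degree `n`. -/
theorem IsOrthonormalFor.form_eq_form (hF : IsShiftForm F) (hφ : IsOrthonormalFor F φ)
    (hG : IsShiftForm G) (n : ℕ)
    (hG1 : ∀ c d, G (vecMulPoly (φ n) c) (vecMulPoly (φ n) d) = c ⬝ᵥ star d)
    (hG0 : ∀ N c d, G (vecMulPoly (φ n) c) ((X ^ (N + 1) : ℂ[X]) • vecMulPoly (φ n) d) = 0)
    (hGb : ∀ u d, ∃ C, ∀ N : ℕ, ‖G u ((X ^ N : ℂ[X]) • vecMulPoly (φ n) d)‖ ≤ C)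
    {u v : PolyVec p} (hu : u ∈ degLT p (n + 1)) (hv : v ∈ degLT p (n + 1)) : F u v = G u v := by
  set T := mulXMod (φ n) n (hφ.natDegree_le n) (hφ.isUnit_det_coeff hF n) with hT
  set b := Module.finBasis ℂ (degLT p n) with hb
  have hlim := fun u i => hφ.repr_mulXMod_pow_tendsto_zero hF n u i
  rw [← hT, ← hb] at hlim
  have hX := X_smul_eq (φ n) n (hφ.natDegree_le n) (hφ.isUnit_det_coeff hF n)
  rw [← hT] at hX
  have hexp : ∀ u : degLT p n, (u : PolyVec p) = ∑ i, b.repr u i • (b i : PolyVec p) := fun u => by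
    refine (congrArg (degLT p n).subtype (b.sum_repr u)).symm.trans ?_
    rw [map_sum]
    rfl
  -- Each shift replaces u by X u = c φ_n + T u, and the φ_n term pairs to zero with X^(N+1) φ_n. So
  -- the value equals G(T^N u, X^N φ_n d), where T^N u → 0 and the other factor stays bounded.
  have orth : ∀ u ∈ degLT p n, ∀ d, G u (vecMulPoly (φ n) d) = 0 := by
    intro u hu d
    lift u to degLT p n using hu
    have step : ∀ N : ℕ, G (u : PolyVec p) (vecMulPoly (φ n) d) =
        G ((T ^ N) u : degLT p n) ((X ^ N : ℂ[X]) • vecMulPoly (φ n) d) := by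
      intro N
      induction N with
      | zero => simp
      | succ N ih =>
        rw [ih, ← hG.shift, hX ((T ^ N) u), ← mul_smul, ← pow_succ', map_add, LinearMap.add_apply,
          hG0, zero_add, pow_succ' T]
        rfl
    choose C hC using fun i => hGb (b i) d
    have h0 : Tendsto (fun N => ∑ i, b.repr ((T ^ N) u) i *
        G (b i) ((X ^ N : ℂ[X]) • vecMulPoly (φ n) d)) atTop
        (𝓝 (∑ _i : Fin (Module.finrank ℂ (degLT p n)), 0)) := by
      refine tendsto_finsetSum _ fun i _ => ?_
      exact (hlim u i).zero_mul_isBoundedUnder_le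
        ⟨C i, eventually_map.2 (Eventually.of_forall fun N => hC i N)⟩
    rw [Finset.sum_const_zero] at h0
    refine tendsto_nhds_unique (tendsto_const_nhds.congr fun N => ?_) h0
    rw [step N]
    conv_lhs => rw [hexp ((T ^ N) u)]
    simp
  -- Passing from u, v to T u, T v removes the same term a b^* from both forms, so F - G is
  -- unchanged by T; but T^N → 0.
  have onV : ∀ u v : degLT p n, F u v = G u v := by
    intro u v
    have step : ∀ N : ℕ, F u v - G u v =
        F ((T ^ N) u : degLT p n) ((T ^ N) v : degLT p n) -
          G ((T ^ N) u : degLT p n) ((T ^ N) v : degLT p n) := by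
      intro N
      induction N with
      | zero => simp
      | succ N ih =>
        rw [ih, ← hF.shift, ← hG.shift, hX ((T ^ N) u), hX ((T ^ N) v),
          hφ.form_add hF (Subtype.prop _) (Subtype.prop _),
          form_vecMulPoly_add hG hG1 orth (Subtype.prop _) (Subtype.prop _), pow_succ' T]
        simp
    have h0 : Tendsto (fun N => ∑ i, ∑ j, b.repr ((T ^ N) u) i *
        (star (b.repr ((T ^ N) v) j) * (F (b i) (b j) - G (b i) (b j)))) atTop
        (𝓝 (∑ _i : Fin (Module.finrank ℂ (degLT p n)),
          ∑ _j : Fin (Module.finrank ℂ (degLT p n)), 0)) := by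
      refine tendsto_finsetSum _ fun i _ => tendsto_finsetSum _ fun j _ => ?_
      simpa using (hlim u i).mul ((hlim v j).star.mul_const (F (b i) (b j) - G (b i) (b j)))
    simp only [Finset.sum_const_zero] at h0
    refine sub_eq_zero.1 (tendsto_nhds_unique (tendsto_const_nhds.congr fun N => ?_) h0)
    rw [step N]
    conv_lhs => rw [hexp ((T ^ N) u), hexp ((T ^ N) v)]
    simp only [map_sum, map_smul, LinearMap.sum_apply, LinearMap.smul_apply, smul_eq_mul,
      LinearMap.map_smulₛₗ, mul_sub, Finset.sum_sub_distrib]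
    have swap : ∀ (r s : Fin (Module.finrank ℂ (degLT p n)) → ℂ)
        (H : Fin (Module.finrank ℂ (degLT p n)) → Fin (Module.finrank ℂ (degLT p n)) → ℂ),
        ∑ x, starRingEnd ℂ (s x) * ∑ y, r y * H y x = ∑ y, ∑ x, r y * (star (s x) * H y x) := by
      intro r s H
      simp_rw [Finset.mul_sum]
      rw [Finset.sum_comm]
      refine Finset.sum_congr rfl fun y _ => Finset.sum_congr rfl fun x _ => ?_
      rw [starRingEnd_apply]
      ring
    exact congrArg₂ (· - ·) (swap _ _ fun y x => F (b y) (b x)) (swap _ _ fun y x => G (b y) (b x))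
  have hκ := hφ.isUnit_det_coeff hF n
  have hu' := sub_vecMulPoly_mem_degLT (hφ.natDegree_le n) hκ hu
  have hv' := sub_vecMulPoly_mem_degLT (hφ.natDegree_le n) hκ hv
  have eu : u = vecMulPoly (φ n) (quotVec (φ n) n u) + (u - vecMulPoly (φ n) (quotVec (φ n) n u)) := by
    abel
  have ev : v = vecMulPoly (φ n) (quotVec (φ n) n v) + (v - vecMulPoly (φ n) (quotVec (φ n) n v)) := by
    abel
  rw [eu, ev, hφ.form_add hF hu' hv', form_vecMulPoly_add hG hG1 orth hu' hv']
  congr 1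
  exact onV ⟨_, hu'⟩ ⟨_, hv'⟩

end ShiftForm

/-! ### Forms given by integration against a matrix density. -/

section IntegralForm

variable {p : ℕ}

instance isProbabilityMeasure_leb : IsProbabilityMeasure leb := by
  unfold leb; infer_instance

theorem continuous_circlePt : Continuous circlePt :=
  continuous_subtype_val.comp AddCircle.continuous_toCircle

theorem norm_circlePt (θ : Angle) : ‖circlePt θ‖ = 1 := Circle.norm_coe _

theorem star_circlePt_mul (θ : Angle) : star (circlePt θ) * circlePt θ = 1 := by
  rw [Complex.star_def, Complex.conj_mul', norm_circlePt]; simp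

/-- The values of a row vector of polynomials on the circle. -/
def evalVec (u : PolyVec p) (θ : Angle) : Fin p → ℂ := fun k => (u k).eval (circlePt θ)

theorem continuous_evalVec (u : PolyVec p) (k : Fin p) : Continuous fun θ => evalVec u θ k :=
  (u k).continuous.comp continuous_circlePt

theorem evalVec_add (u v : PolyVec p) (θ : Angle) :
    evalVec (u + v) θ = evalVec u θ + evalVec v θ := by
  ext k; simp [evalVec]

theorem evalVec_smul (a : ℂ) (u : PolyVec p) (θ : Angle) :
    evalVec (a • u) θ = a • evalVec u θ := by
  ext k; simp [evalVec]

theorem evalVec_poly_smul (f : ℂ[X]) (u : PolyVec p) (θ : Angle) :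
    evalVec (f • u) θ = f.eval (circlePt θ) • evalVec u θ := by
  ext k; simp [evalVec]

theorem evalAt_eq (P : (Matrix (Fin p) (Fin p) ℂ)[X]) (z : ℂ) :
    evalAt P z = (matPolyEquiv.symm P).map (Polynomial.eval z) := by
  rw [matPolyEquiv_symm_map_eval, eval_eq_sum, evalAt]
  refine Finset.sum_congr rfl fun k _ => ?_
  simp only
  rw [← map_pow, Matrix.scalar_apply, ← smul_one_eq_diagonal, Matrix.mul_smul, Matrix.mul_one]

theorem evalVec_vecMulPoly (P : (Matrix (Fin p) (Fin p) ℂ)[X]) (c : Fin p → ℂ) (θ : Angle) :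
    evalVec (vecMulPoly P c) θ = c ᵥ* evalAt P (circlePt θ) := by
  ext k
  rw [evalAt_eq, evalVec, eval_vecMulPoly]

theorem continuous_evalAt (P : (Matrix (Fin p) (Fin p) ℂ)[X]) :
    Continuous fun θ : Angle => evalAt P (circlePt θ) := by
  refine continuous_matrix fun i j => ?_
  simp only [evalAt_eq, Matrix.map_apply]
  exact (Polynomial.continuous _).comp continuous_circlePt

theorem integrable_continuous_mul {μ : Measure Angle} {f g : Angle → ℂ} (hf : Continuous f)
    (hg : Integrable g μ) : Integrable (fun θ => f θ * g θ) μ := by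
  obtain ⟨C, hC⟩ := isCompact_univ.exists_bound_of_continuousOn hf.continuousOn
  exact hg.bdd_mul hf.aestronglyMeasurable (Eventually.of_forall fun x => hC x trivial)

theorem integrable_dotProduct_mulVec {μ : Measure Angle} {M : Angle → Matrix (Fin p) (Fin p) ℂ}
    (hM : ∀ k l, Integrable (fun θ => M θ k l) μ) {u v : Angle → Fin p → ℂ}
    (hu : ∀ k, Continuous fun θ => u θ k) (hv : ∀ k, Continuous fun θ => v θ k) :
    Integrable (fun θ => u θ ⬝ᵥ (M θ *ᵥ v θ)) μ := by
  simp only [dotProduct, mulVec]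
  refine integrable_finsetSum _ fun k _ => integrable_continuous_mul (hu k)
    (integrable_finsetSum _ fun l _ => ?_)
  simpa only [mul_comm] using integrable_continuous_mul (hv l) (hM k l)

theorem integrable_form {μ : Measure Angle} {M : Angle → Matrix (Fin p) (Fin p) ℂ}
    (hM : ∀ k l, Integrable (fun θ => M θ k l) μ) (u v : PolyVec p) :
    Integrable (fun θ => evalVec u θ ⬝ᵥ (M θ *ᵥ star (evalVec v θ))) μ :=
  integrable_dotProduct_mulVec hM (continuous_evalVec u) fun k => (continuous_evalVec v k).star

/-- The form `∫ u M v^* dμ` on row vectors of polynomials. -/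
def intForm (μ : Measure Angle) (M : Angle → Matrix (Fin p) (Fin p) ℂ)
    (hM : ∀ k l, Integrable (fun θ => M θ k l) μ) : PolyVec p →ₗ[ℂ] PolyVec p →ₗ⋆[ℂ] ℂ :=
  LinearMap.mk₂'ₛₗ (RingHom.id ℂ) (starRingEnd ℂ)
    (fun u v => ∫ θ, evalVec u θ ⬝ᵥ (M θ *ᵥ star (evalVec v θ)) ∂μ)
    (fun u₁ u₂ v => by
      simp only [evalVec_add, add_dotProduct]
      exact integral_add (integrable_form hM _ _) (integrable_form hM _ _))
    (fun a u v => by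
      simp only [evalVec_smul, smul_dotProduct]
      exact integral_smul a _)
    (fun u v₁ v₂ => by
      simp only [evalVec_add, star_add, mulVec_add, dotProduct_add]
      exact integral_add (integrable_form hM _ _) (integrable_form hM _ _))
    (fun a u v => by
      simp only [evalVec_smul, star_smul, mulVec_smul, dotProduct_smul]
      exact integral_smul (star a) _)

theorem intForm_apply {μ : Measure Angle} {M : Angle → Matrix (Fin p) (Fin p) ℂ}
    (hM : ∀ k l, Integrable (fun θ => M θ k l) μ) (u v : PolyVec p) :
    intForm μ M hM u v = ∫ θ, evalVec u θ ⬝ᵥ (M θ *ᵥ star (evalVec v θ)) ∂μ := rfl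

theorem isShiftForm_intForm {μ : Measure Angle} {M : Angle → Matrix (Fin p) (Fin p) ℂ}
    (hM : ∀ k l, Integrable (fun θ => M θ k l) μ) (hpsd : ∀ θ, (M θ).PosSemidef) :
    IsShiftForm (intForm μ M hM) where
  shift u v := by
    simp only [intForm_apply, evalVec_poly_smul, eval_X, star_smul, mulVec_smul, dotProduct_smul,
      smul_dotProduct, smul_smul, star_circlePt_mul, one_smul]
  nonneg u := by
    rw [intForm_apply]
    refine integral_nonneg fun θ => ?_
    simpa using (hpsd θ).dotProduct_mulVec_nonneg (star (evalVec u θ))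
  symm u v := by
    rw [intForm_apply, intForm_apply, Complex.star_def, ← integral_conj]
    refine integral_congr_ae (Eventually.of_forall fun θ => ?_)
    simp only [starRingEnd_apply]
    have h : M θ *ᵥ star (evalVec v θ) = star (evalVec v θ ᵥ* M θ) := by
      rw [star_vecMul, (hpsd θ).1.eq]
    rw [h, dotProduct_star, star_star, dotProduct_mulVec]

end IntegralForm

/-! ### Bernstein–Szegő weights: equal moments and weak convergence. -/

section BernsteinSzego

variable {p : ℕ}

/-- The Bernstein–Szegő weight `φ_n⁻¹ (φ_n⁻¹)^*`. -/
def bsWeight (φ : ℕ → (Matrix (Fin p) (Fin p) ℂ)[X]) (n : ℕ) (θ : Angle) :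
    Matrix (Fin p) (Fin p) ℂ :=
  (evalAt (φ n) (circlePt θ))⁻¹ * (evalAt (φ n) (circlePt θ))⁻¹ᴴ

theorem bsWeight_posSemidef (φ : ℕ → (Matrix (Fin p) (Fin p) ℂ)[X]) (n : ℕ) (θ : Angle) :
    (bsWeight φ n θ).PosSemidef := posSemidef_self_mul_conjTranspose _

theorem continuous_bsWeight {φ : ℕ → (Matrix (Fin p) (Fin p) ℂ)[X]} {n : ℕ}
    (h : ∀ θ, (evalAt (φ n) (circlePt θ)).det ≠ 0) : Continuous (bsWeight φ n) := by
  have h1 : Continuous fun θ : Angle => (evalAt (φ n) (circlePt θ))⁻¹ := by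
    simp only [Matrix.inv_def, Ring.inverse_eq_inv']
    exact ((continuous_evalAt (φ n)).matrix_det.inv₀ h).smul (continuous_evalAt (φ n)).matrix_adjugate
  exact h1.matrix_mul h1.matrix_conjTranspose

theorem integrable_of_continuous {f : Angle → ℂ} (hf : Continuous f) : Integrable f leb := by
  simpa using integrable_continuous_mul hf (integrable_const (1 : ℂ) : Integrable _ leb)

theorem fourier_natCast (n : ℕ) (θ : Angle) : fourier (n : ℤ) θ = circlePt θ ^ n := by
  rw [fourier_apply, AddCircle.toCircle_zsmul, circlePt]
  simp

theorem fourier_neg_natCast (n : ℕ) (θ : Angle) :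
    fourier (-(n : ℤ)) θ = star (circlePt θ) ^ n := by
  rw [fourier_neg, fourier_natCast, map_pow]
  rfl

theorem integral_star_circlePt_pow (N : ℕ) : ∫ θ, star (circlePt θ) ^ (N + 1) ∂leb = 0 := by
  have h := congrFun (fourierCoeff_fourier (T := 2 * Real.pi) 0) ((N + 1 : ℕ) : ℤ)
  rw [fourierCoeff, Pi.single_eq_of_ne (by positivity)] at h
  rw [← h]
  refine integral_congr_ae (Eventually.of_forall fun θ => ?_)
  simp only [fourier_neg_natCast]
  rw [fourier_zero, smul_eq_mul, mul_one]

theorem fourier_eq_circlePt (k : ℤ) : ∃ i j : ℕ, i ≤ k.natAbs ∧ j ≤ k.natAbs ∧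
    ∀ θ : Angle, fourier k θ = circlePt θ ^ i * star (circlePt θ) ^ j := by
  obtain ⟨n, rfl | rfl⟩ := Int.eq_nat_or_neg k
  · exact ⟨n, 0, by simp, by simp, fun θ => by rw [fourier_natCast, pow_zero, mul_one]⟩
  · exact ⟨0, n, by simp, by simp, fun θ => by rw [fourier_neg_natCast, pow_zero, one_mul]⟩

/-- The weight cancels Q on both sides, so the integrands in the Bernstein–Szegő form of φ_n with
itself become constants. -/
theorem dotProduct_bsWeight {Q : Matrix (Fin p) (Fin p) ℂ} (hQ : IsUnit Q.det) (c d : Fin p → ℂ) :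
    (c ᵥ* Q) ⬝ᵥ ((Q⁻¹ * Q⁻¹ᴴ) *ᵥ star (d ᵥ* Q)) = c ⬝ᵥ star d := by
  have h1 : Q⁻¹ᴴ * Qᴴ = 1 := by
    rw [← conjTranspose_mul, mul_nonsing_inv Q hQ, conjTranspose_one]
  rw [star_vecMul, mulVec_mulVec, Matrix.mul_assoc, h1, Matrix.mul_one, ← dotProduct_mulVec,
    mulVec_mulVec, mul_nonsing_inv Q hQ, one_mulVec]

variable {ν : Measure Angle} {M : Angle → Matrix (Fin p) (Fin p) ℂ}
  {φ : ℕ → (Matrix (Fin p) (Fin p) ℂ)[X]}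

/-- The Bernstein–Szegő weight has the same moments as the original measure. -/
theorem intForm_bsWeight (hM : ∀ k l, Integrable (fun θ => M θ k l) ν)
    (hpsd : ∀ θ, (M θ).PosSemidef) (hφ : IsOrthonormalFor (intForm ν M hM) φ) (n : ℕ)
    {u v : PolyVec p} (hu : u ∈ degLT p (n + 1)) (hv : v ∈ degLT p (n + 1)) :
    ∫ θ, evalVec u θ ⬝ᵥ (bsWeight φ n θ *ᵥ star (evalVec v θ)) ∂leb =
      ∫ θ, evalVec u θ ⬝ᵥ (M θ *ᵥ star (evalVec v θ)) ∂ν := by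
  have hF := isShiftForm_intForm hM hpsd
  have hdet : ∀ θ, (evalAt (φ n) (circlePt θ)).det ≠ 0 := fun θ => by
    rw [evalAt_eq]; exact hφ.det_eval_ne_zero hF n (norm_circlePt θ)
  have hW : ∀ k l, Integrable (fun θ => bsWeight φ n θ k l) leb := fun k l =>
    integrable_of_continuous ((continuous_bsWeight hdet).matrix_elem k l)
  have hG := isShiftForm_intForm hW (bsWeight_posSemidef φ n)
  refine (hφ.form_eq_form hF hG n ?_ ?_ ?_ hu hv).symm
  · intro c d
    simp only [intForm_apply, evalVec_vecMulPoly, bsWeight]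
    simp_rw [dotProduct_bsWeight (isUnit_iff_ne_zero.2 (hdet _))]
    simp
  -- The integrand is a constant times the conjugate of z^(N+1), whose mean is zero.
  · intro N c d
    simp only [intForm_apply, evalVec_poly_smul, evalVec_vecMulPoly, bsWeight, star_smul,
      mulVec_smul, dotProduct_smul]
    simp_rw [dotProduct_bsWeight (isUnit_iff_ne_zero.2 (hdet _))]
    simp only [eval_pow, eval_X, star_pow, smul_eq_mul]
    rw [integral_mul_const, integral_star_circlePt_pow, zero_mul]
  -- Since |z^N| = 1, the integral of the norm does not depend on N.
  · intro u d
    refine ⟨∫ θ, ‖evalVec u θ ⬝ᵥ (bsWeight φ n θ *ᵥ star (evalVec (vecMulPoly (φ n) d) θ))‖ ∂leb,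
      fun N => ?_⟩
    rw [intForm_apply]
    refine (norm_integral_le_integral_norm _).trans (le_of_eq ?_)
    refine integral_congr_ae (Eventually.of_forall fun θ => ?_)
    simp [evalVec_poly_smul, star_smul, mulVec_smul, dotProduct_smul, norm_circlePt]

theorem integral_bsWeight_circlePt_pow (hM : ∀ k l, Integrable (fun θ => M θ k l) ν)
    (hpsd : ∀ θ, (M θ).PosSemidef) (hφ : IsOrthonormalFor (intForm ν M hM) φ) {n i j : ℕ}
    (hi : i ≤ n) (hj : j ≤ n) (k l : Fin p) :
    ∫ θ, circlePt θ ^ i * star (circlePt θ) ^ j * bsWeight φ n θ k l ∂leb =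
      ∫ θ, circlePt θ ^ i * star (circlePt θ) ^ j * M θ k l ∂ν := by
  have hdeg : ∀ (i : ℕ) (k : Fin p), i ≤ n →
      (Pi.single k (X ^ i : ℂ[X]) : PolyVec p) ∈ degLT p (n + 1) := fun i k hi k' j hj => by
    by_cases h : k' = k
    · subst h; rw [Pi.single_eq_same, coeff_X_pow, if_neg (by omega)]
    · rw [Pi.single_eq_of_ne h, coeff_zero]
  have hev : ∀ (i : ℕ) (k : Fin p) θ, evalVec (Pi.single k (X ^ i : ℂ[X]) : PolyVec p) θ =
      Pi.single k (circlePt θ ^ i) := fun i k θ => by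
    ext k'
    by_cases h : k' = k
    · subst h; simp [evalVec]
    · simp [evalVec, Pi.single_eq_of_ne h]
  have h := intForm_bsWeight hM hpsd hφ n (hdeg i k hi) (hdeg j l hj)
  have key : ∀ (N : Matrix (Fin p) (Fin p) ℂ) (x y : ℂ),
      (Pi.single k x : Fin p → ℂ) ⬝ᵥ (N *ᵥ star (Pi.single l y)) = x * star y * N k l := by
    intro N x y
    rw [← Pi.single_star, single_dotProduct, mulVec_single]
    simp [mul_comm, mul_left_comm]
  simpa only [hev, key, star_pow] using h

theorem integral_trace_bsWeight (hM : ∀ k l, Integrable (fun θ => M θ k l) ν)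
    (hpsd : ∀ θ, (M θ).PosSemidef) (hφ : IsOrthonormalFor (intForm ν M hM) φ) (n : ℕ)
    (hW : Continuous (bsWeight φ n)) :
    ∫ θ, (bsWeight φ n θ).trace ∂leb = ∫ θ, (M θ).trace ∂ν := by
  simp only [trace, diag_apply]
  rw [integral_finsetSum _ fun i _ => integrable_of_continuous (hW.matrix_elem i i),
    integral_finsetSum _ fun i _ => hM i i]
  refine Finset.sum_congr rfl fun i _ => ?_
  simpa using integral_bsWeight_circlePt_pow hM hpsd hφ (Nat.zero_le n) (Nat.zero_le n) i i

/-- Positivity bounds each entry by the trace, whose integral is a zeroth moment and so independent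
of n. This uniform bound drives the density argument. -/
theorem integral_norm_bsWeight_le (hM : ∀ k l, Integrable (fun θ => M θ k l) ν)
    (hpsd : ∀ θ, (M θ).PosSemidef) (hφ : IsOrthonormalFor (intForm ν M hM) φ) (n : ℕ)
    (hW : Continuous (bsWeight φ n)) (k l : Fin p) :
    ∫ θ, ‖bsWeight φ n θ k l‖ ∂leb ≤ (∫ θ, (M θ).trace ∂ν).re := by
  rw [← integral_trace_bsWeight hM hpsd hφ n hW]
  have htri : Integrable (fun θ => (bsWeight φ n θ).trace) leb :=
    integrable_of_continuous hW.matrix_trace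
  have : (∫ θ, (bsWeight φ n θ).trace ∂leb).re = ∫ θ, (bsWeight φ n θ).trace.re ∂leb :=
    (integral_re htri).symm
  rw [this]
  exact integral_mono (integrable_of_continuous (hW.matrix_elem k l)).norm htri.re
    fun θ => norm_apply_le_trace (bsWeight_posSemidef φ n θ) k l

/-- The Bernstein–Szegő measures converge weakly to the original measure. -/
theorem tendsto_integral_bsWeight (hM : ∀ k l, Integrable (fun θ => M θ k l) ν)
    (hpsd : ∀ θ, (M θ).PosSemidef) (hφ : IsOrthonormalFor (intForm ν M hM) φ)
    (hW : ∀ n, Continuous (bsWeight φ n)) (k l : Fin p) {f : Angle → ℂ} (hf : Continuous f) :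
    Tendsto (fun n => ∫ θ, f θ * bsWeight φ n θ k l ∂leb) atTop (𝓝 (∫ θ, f θ * M θ k l ∂ν)) := by
  set K := (∫ θ, (M θ).trace ∂ν).re + ∫ θ, ‖M θ k l‖ ∂ν with hK
  have hWi : ∀ n, Integrable (fun θ => bsWeight φ n θ k l) leb := fun n =>
    integrable_of_continuous ((hW n).matrix_elem k l)
  have hK0 : 0 ≤ K := add_nonneg
    ((integral_nonneg fun _ => norm_nonneg _).trans
      (integral_norm_bsWeight_le hM hpsd hφ 0 (hW 0) k l)) (integral_nonneg fun _ => norm_nonneg _)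
  let L : ℕ → C(Angle, ℂ) → ℂ := fun n g =>
    ∫ θ, g θ * bsWeight φ n θ k l ∂leb - ∫ θ, g θ * M θ k l ∂ν
  have hLsub : ∀ n g h, L n (g - h) = L n g - L n h := fun n g h => by
    simp only [L, ContinuousMap.sub_apply, sub_mul]
    rw [integral_sub (integrable_continuous_mul g.continuous (hWi n))
        (integrable_continuous_mul h.continuous (hWi n)),
      integral_sub (integrable_continuous_mul g.continuous (hM k l))
        (integrable_continuous_mul h.continuous (hM k l))]
    ring
  have hLadd : ∀ n g h, L n (g + h) = L n g + L n h := fun n g h => by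
    simp only [L, ContinuousMap.add_apply, add_mul]
    rw [integral_add (integrable_continuous_mul g.continuous (hWi n))
        (integrable_continuous_mul h.continuous (hWi n)),
      integral_add (integrable_continuous_mul g.continuous (hM k l))
        (integrable_continuous_mul h.continuous (hM k l))]
    ring
  have hLsmul : ∀ n (a : ℂ) g, L n (a • g) = a * L n g := fun n a g => by
    simp only [L, ContinuousMap.smul_apply, smul_eq_mul, mul_assoc]
    rw [integral_const_mul, integral_const_mul, mul_sub]
  have hLle : ∀ n g, ‖L n g‖ ≤ ‖g‖ * K := fun n g => by
    have key : ∀ (μ : Measure Angle) (h : Angle → ℂ), Integrable h μ →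
        ‖∫ θ, g θ * h θ ∂μ‖ ≤ ‖g‖ * ∫ θ, ‖h θ‖ ∂μ := fun μ h hh => by
      refine (norm_integral_le_integral_norm _).trans ?_
      rw [← integral_const_mul]
      refine integral_mono (integrable_continuous_mul g.continuous hh).norm
        (hh.norm.const_mul _) fun θ => ?_
      simp only [norm_mul]
      exact mul_le_mul_of_nonneg_right (g.norm_coe_le_norm θ) (norm_nonneg _)
    refine (norm_sub_le _ _).trans ?_
    rw [hK, mul_add]
    exact add_le_add ((key leb _ (hWi n)).trans (mul_le_mul_of_nonneg_left
      (integral_norm_bsWeight_le hM hpsd hφ n (hW n) k l) (norm_nonneg _))) (key ν _ (hM k l))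
  -- On a trigonometric polynomial the error is exactly zero once n reaches its degree.
  have hspan : ∀ g ∈ Submodule.span ℂ (Set.range (fourier : ℤ → C(Angle, ℂ))),
      ∀ᶠ n in atTop, L n g = 0 := by
    intro g hg
    induction hg using Submodule.span_induction with
    | mem x hx =>
      obtain ⟨m, rfl⟩ := hx
      obtain ⟨i, j, hi, hj, hij⟩ := fourier_eq_circlePt m
      filter_upwards [eventually_ge_atTop m.natAbs] with n hn
      simp only [L, hij]
      rw [integral_bsWeight_circlePt_pow hM hpsd hφ (hi.trans hn) (hj.trans hn), sub_self]
    | zero => exact Eventually.of_forall fun n => by simp [L]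
    | add x y _ _ hx hy =>
      filter_upwards [hx, hy] with n h1 h2
      rw [hLadd, h1, h2, add_zero]
    | smul a x _ hx =>
      filter_upwards [hx] with n h1
      rw [hLsmul, h1, mul_zero]
  have hlim : Tendsto (fun n => L n ⟨f, hf⟩) atTop (𝓝 0) := by
    rw [Metric.tendsto_nhds]
    intro ε hε
    have hmem : (⟨f, hf⟩ : C(Angle, ℂ)) ∈
        (Submodule.span ℂ (Set.range (fourier : ℤ → C(Angle, ℂ)))).topologicalClosure := by
      rw [span_fourier_closure_eq_top]; trivial
    -- Dividing by K + 1 covers the case K = 0.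
    obtain ⟨g, hg, hgf⟩ := Metric.mem_closure_iff.1 hmem (ε / (K + 1)) (by positivity)
    filter_upwards [hspan g hg] with n hn
    have h1 : L n ⟨f, hf⟩ = L n (⟨f, hf⟩ - g) := by rw [hLsub, hn, sub_zero]
    rw [dist_zero_right, h1]
    refine (hLle n _).trans_lt ?_
    rw [← dist_eq_norm]
    calc dist (⟨f, hf⟩ : C(Angle, ℂ)) g * K ≤ ε / (K + 1) * K :=
          mul_le_mul_of_nonneg_right hgf.le hK0
      _ < ε := by
        rw [div_mul_eq_mul_div, div_lt_iff₀ (by positivity)]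
        nlinarith
  have := hlim.add_const (∫ θ, f θ * M θ k l ∂ν)
  simpa [L] using this

end BernsteinSzego

/-! ### Orthonormality in trace form. -/

section Orthonormality

variable {p : ℕ} {ν : Measure Angle} {M : Angle → Matrix (Fin p) (Fin p) ℂ}
  {φ : ℕ → (Matrix (Fin p) (Fin p) ℂ)[X]}

theorem evalVec_vecMulPoly_single (P : (Matrix (Fin p) (Fin p) ℂ)[X]) (i : Fin p) (θ : Angle) :
    evalVec (vecMulPoly P (Pi.single i 1)) θ = evalAt P (circlePt θ) i := by
  rw [evalVec_vecMulPoly, single_one_vecMul]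
  rfl

theorem intForm_vecMulPoly_single {ρ : MatrixMeasure p} (hM : ∀ k l, Integrable (fun θ => M θ k l) ν)
    (hρ : ∀ k l, ∀ f : Angle → ℂ, Continuous f →
      cintegral f (ρ.entry k l) = ∫ θ, f θ * M θ k l ∂ν)
    (P Q : (Matrix (Fin p) (Fin p) ℂ)[X]) (i j : Fin p) :
    intForm ν M hM (vecMulPoly P (Pi.single i 1)) (vecMulPoly Q (Pi.single j 1)) =
      ρ.leftInner P Q i j := by
  have hc : ∀ k l, Continuous fun θ => evalAt P (circlePt θ) i k * star (evalAt Q (circlePt θ) j l) :=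
    fun k l => ((continuous_evalAt P).matrix_elem i k).mul ((continuous_evalAt Q).matrix_elem j l).star
  rw [intForm_apply]
  simp only [evalVec_vecMulPoly_single, MatrixMeasure.leftInner, MatrixMeasure.integral,
    Matrix.of_apply]
  simp_rw [hρ _ _ _ (hc _ _)]
  have e : ∀ θ, evalAt P (circlePt θ) i ⬝ᵥ (M θ *ᵥ star (evalAt Q (circlePt θ) j)) =
      ∑ k, ∑ l, evalAt P (circlePt θ) i k * star (evalAt Q (circlePt θ) j l) * M θ k l := fun θ => by
    simp only [dotProduct, mulVec, Finset.mul_sum, Pi.star_apply]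
    exact Finset.sum_congr rfl fun k _ => Finset.sum_congr rfl fun l _ => by ring
  simp_rw [e]
  rw [integral_finsetSum _ fun k _ => integrable_finsetSum _ fun l _ =>
    integrable_continuous_mul (hc k l) (hM k l)]
  refine Finset.sum_congr rfl fun k _ => ?_
  rw [integral_finsetSum _ fun l _ => integrable_continuous_mul (hc k l) (hM k l)]

theorem IsLeftOrthonormal.isOrthonormalFor {ρ : MatrixMeasure p} (hφ : IsLeftOrthonormal ρ φ)
    (hM : ∀ k l, Integrable (fun θ => M θ k l) ν)
    (hρ : ∀ k l, ∀ f : Angle → ℂ, Continuous f →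
      cintegral f (ρ.entry k l) = ∫ θ, f θ * M θ k l ∂ν) :
    IsOrthonormalFor (intForm ν M hM) φ where
  natDegree_le := hφ.natDegree_le
  inner_eq n m c d := by
    rw [vecMulPoly_eq_sum (φ n) c, vecMulPoly_eq_sum (φ m) d]
    simp only [map_sum, map_smul, LinearMap.sum_apply, LinearMap.smul_apply,
      LinearMap.map_smulₛₗ, intForm_vecMulPoly_single hM hρ, hφ.inner_eq]
    split_ifs with h
    · simp [Matrix.one_apply, dotProduct, mul_comm]
    · simp

theorem trace_conj_eq_sum (A N : Matrix (Fin p) (Fin p) ℂ) :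
    (A * N * Aᴴ).trace = ∑ i, A i ⬝ᵥ (N *ᵥ star (A i)) := by
  refine Finset.sum_congr rfl fun i _ => ?_
  rw [diag_apply, Matrix.mul_assoc, Matrix.mul_apply]
  refine Finset.sum_congr rfl fun k _ => ?_
  rw [Matrix.mul_apply]
  rfl

theorem integrable_trace_conj {μ : Measure Angle} {N : Angle → Matrix (Fin p) (Fin p) ℂ}
    (hN : ∀ k l, Integrable (fun θ => N θ k l) μ) (P : (Matrix (Fin p) (Fin p) ℂ)[X]) :
    Integrable (fun θ => (evalAt P (circlePt θ) * N θ * (evalAt P (circlePt θ))ᴴ).trace) μ := by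
  simp only [trace_conj_eq_sum, ← evalVec_vecMulPoly_single]
  exact integrable_finsetSum _ fun i _ => integrable_form hN _ _

theorem integral_trace_conj (hM : ∀ k l, Integrable (fun θ => M θ k l) ν)
    (hφ : IsOrthonormalFor (intForm ν M hM) φ) (n : ℕ) :
    ∫ θ, (evalAt (φ n) (circlePt θ) * M θ * (evalAt (φ n) (circlePt θ))ᴴ).trace ∂ν = p := by
  simp only [trace_conj_eq_sum, ← evalVec_vecMulPoly_single]
  rw [integral_finsetSum _ fun i _ => integrable_form hM _ _]
  simp_rw [← intForm_apply hM, hφ.inner_eq]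
  simp

/-- The rows of φ_n have degree at most n ≤ m, within the range where the weight of index m
reproduces the inner product. -/
theorem integral_trace_conj_bsWeight (hM : ∀ k l, Integrable (fun θ => M θ k l) ν)
    (hpsd : ∀ θ, (M θ).PosSemidef) (hφ : IsOrthonormalFor (intForm ν M hM) φ) {n m : ℕ}
    (hnm : n ≤ m) (hW : Continuous (bsWeight φ m)) :
    ∫ θ, (evalAt (φ n) (circlePt θ) * bsWeight φ m θ * (evalAt (φ n) (circlePt θ))ᴴ).trace ∂leb =
      p := by
  rw [← integral_trace_conj hM hφ n]
  simp only [trace_conj_eq_sum, ← evalVec_vecMulPoly_single]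
  rw [integral_finsetSum _ fun i _ => integrable_form hM _ _,
    integral_finsetSum _ fun i _ => integrable_form
      (fun k l => integrable_of_continuous (hW.matrix_elem k l)) _ _]
  refine Finset.sum_congr rfl fun i _ => ?_
  have h : vecMulPoly (φ n) (Pi.single i 1) ∈ degLT p (m + 1) :=
    degLT_mono (Nat.succ_le_succ hnm) (vecMulPoly_mem_degLT (hφ.natDegree_le n) _)
  exact intForm_bsWeight hM hpsd hφ m h h

theorem trace_mul_eq_sum (A B : Matrix (Fin p) (Fin p) ℂ) :
    (A * B).trace = ∑ k, ∑ l, A k l * B l k := rfl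

theorem integrable_trace_mul {μ : Measure Angle} {g N : Angle → Matrix (Fin p) (Fin p) ℂ}
    (hg : Continuous g) (hN : ∀ k l, Integrable (fun θ => N θ k l) μ) :
    Integrable (fun θ => (g θ * N θ).trace) μ := by
  simp only [trace_mul_eq_sum]
  exact integrable_finsetSum _ fun k _ => integrable_finsetSum _ fun l _ =>
    integrable_continuous_mul (hg.matrix_elem k l) (hN l k)

theorem tendsto_integral_trace_mul_bsWeight (hM : ∀ k l, Integrable (fun θ => M θ k l) ν)
    (hpsd : ∀ θ, (M θ).PosSemidef) (hφ : IsOrthonormalFor (intForm ν M hM) φ)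
    (hW : ∀ n, Continuous (bsWeight φ n)) {g : Angle → Matrix (Fin p) (Fin p) ℂ}
    (hg : Continuous g) :
    Tendsto (fun n => ∫ θ, (g θ * bsWeight φ n θ).trace.re ∂leb) atTop
      (𝓝 (∫ θ, (g θ * M θ).trace.re ∂ν)) := by
  have hre : ∀ {μ : Measure Angle} {N : Angle → Matrix (Fin p) (Fin p) ℂ},
      (∀ k l, Integrable (fun θ => N θ k l) μ) →
      ∫ θ, (g θ * N θ).trace.re ∂μ = (∑ k, ∑ l, ∫ θ, g θ k l * N θ l k ∂μ).re := fun {μ N} hN => by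
    have h1 : ∫ θ, (g θ * N θ).trace.re ∂μ = (∫ θ, (g θ * N θ).trace ∂μ).re :=
      integral_re (integrable_trace_mul hg hN)
    rw [h1]
    simp only [trace_mul_eq_sum]
    rw [integral_finsetSum _ fun k _ => integrable_finsetSum _ fun l _ =>
      integrable_continuous_mul (hg.matrix_elem k l) (hN l k)]
    congr 1
    refine Finset.sum_congr rfl fun k _ => ?_
    rw [integral_finsetSum _ fun l _ => integrable_continuous_mul (hg.matrix_elem k l) (hN l k)]
  rw [hre hM]
  simp_rw [fun n => hre fun k l => integrable_of_continuous ((hW n).matrix_elem k l)]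
  refine (Complex.continuous_re.tendsto _).comp ?_
  exact tendsto_finsetSum _ fun k _ => tendsto_finsetSum _ fun l _ =>
    tendsto_integral_bsWeight hM hpsd hφ hW l k (hg.matrix_elem k l)

end Orthonormality

/-! ### Continuous approximation in mean with values in a convex cone. -/

section Approximation

/-- Functions with values in a convex cone can be approximated in `L¹` by continuous functions with
values in the cone. -/
theorem exists_continuous_mem_cone {E : Type*} [NormedAddCommGroup E] [NormedSpace ℝ E]
    [MeasurableSpace E] [BorelSpace E] [SecondCountableTopology E] {C : Set E} (h0 : (0 : E) ∈ C)
    (hadd : ∀ x ∈ C, ∀ y ∈ C, x + y ∈ C) (hsmul : ∀ r : ℝ, 0 ≤ r → ∀ x ∈ C, r • x ∈ C)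
    {τ : Measure Angle} [IsFiniteMeasure τ] {f : Angle → E} (hf : Measurable f)
    (hfi : Integrable f τ) (hfC : ∀ θ, f θ ∈ C) {ε : ℝ≥0∞} (hε : ε ≠ 0) :
    ∃ g : Angle → E, Continuous g ∧ (∀ θ, g θ ∈ C) ∧ ∫⁻ θ, ‖f θ - g θ‖ₑ ∂τ ≤ ε := by
  have hsimple : ∀ s : SimpleFunc Angle E, (∀ θ, s θ ∈ C) → ∀ ε : ℝ≥0∞, ε ≠ 0 →
      ∃ g : Angle → E, Continuous g ∧ (∀ θ, g θ ∈ C) ∧ ∫⁻ θ, ‖s θ - g θ‖ₑ ∂τ ≤ ε := by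
    intro s
    induction s using SimpleFunc.induction with
    | const c hs =>
      rename_i s
      intro hC ε hε
      rcases s.eq_empty_or_nonempty with rfl | ⟨x, hx⟩
      · exact ⟨fun _ => 0, continuous_const, fun _ => h0, by simp⟩
      have hc : c ∈ C := by simpa [hx] using hC x
      have hint : Integrable (s.indicator fun _ => (1 : ℝ)) τ := (integrable_const _).indicator hs
      obtain ⟨h, hh, -⟩ := hint.exists_boundedContinuous_lintegral_sub_le
        (ε := ε / (‖c‖ₑ + 1)) (ENNReal.div_ne_zero.2 ⟨hε, by finiteness⟩)
      -- Truncating at 0 keeps the values in the cone and cannot increase the distance to a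
      -- nonnegative indicator.
      refine ⟨fun θ => max (h θ) 0 • c, (h.continuous.max continuous_const).smul continuous_const,
        fun θ => hsmul _ (le_max_right _ _) _ hc, ?_⟩
      have hpt : ∀ θ, ‖(SimpleFunc.piecewise s hs (SimpleFunc.const Angle c)
          (SimpleFunc.const Angle 0) : SimpleFunc Angle E) θ - max (h θ) 0 • c‖ₑ ≤
          ‖s.indicator (fun _ => (1 : ℝ)) θ - h θ‖ₑ * (‖c‖ₑ + 1) := fun θ => by
        have e : (SimpleFunc.piecewise s hs (SimpleFunc.const Angle c)
          (SimpleFunc.const Angle 0) : SimpleFunc Angle E) θ =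
          (s.indicator (fun _ => (1 : ℝ)) θ) • c := by
          by_cases hθ : θ ∈ s <;> simp [hθ]
        have h2 : |s.indicator (fun _ => (1 : ℝ)) θ - max (h θ) 0| ≤
            |s.indicator (fun _ => (1 : ℝ)) θ - h θ| := by
          have h3 : 0 ≤ s.indicator (fun _ => (1 : ℝ)) θ :=
            Set.indicator_nonneg (fun _ _ => zero_le_one) θ
          have := abs_max_sub_max_le_abs (s.indicator (fun _ => (1 : ℝ)) θ) (h θ) 0
          rwa [max_eq_left h3] at this
        rw [e, ← sub_smul, enorm_smul]
        refine mul_le_mul' ?_ le_self_add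
        rw [enorm_le_iff_norm_le]
        exact h2
      refine (lintegral_mono hpt).trans ?_
      rw [lintegral_mul_const' _ _ (by finiteness)]
      refine (mul_le_mul_left hh _).trans ?_
      rw [ENNReal.div_mul_cancel (by simp) (by finiteness)]
    | add hd hf hg =>
      rename_i f g
      intro hC ε hε
      -- The supports are disjoint, so each summand is either 0 or equal to the sum, hence lies in
      -- the cone.
      have hfC : ∀ θ, f θ ∈ C := fun θ => by
        by_cases h : f θ = 0
        · rw [h]; exact h0
        · have : g θ = 0 := by
            by_contra h'
            exact Set.disjoint_left.1 hd h h'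
          simpa [this] using hC θ
      have hgC : ∀ θ, g θ ∈ C := fun θ => by
        by_cases h : g θ = 0
        · rw [h]; exact h0
        · have : f θ = 0 := by
            by_contra h'
            exact Set.disjoint_left.1 hd h' h
          simpa [this] using hC θ
      obtain ⟨u, hu, huC, hu'⟩ := hf hfC (ε / 2) (ENNReal.half_pos hε).ne'
      obtain ⟨v, hv, hvC, hv'⟩ := hg hgC (ε / 2) (ENNReal.half_pos hε).ne'
      refine ⟨fun θ => u θ + v θ, hu.add hv, fun θ => hadd _ (huC θ) _ (hvC θ), ?_⟩
      calc ∫⁻ θ, ‖(f + g) θ - (u θ + v θ)‖ₑ ∂τ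
          ≤ ∫⁻ θ, (‖f θ - u θ‖ₑ + ‖g θ - v θ‖ₑ) ∂τ := lintegral_mono fun θ => by
            rw [SimpleFunc.coe_add, Pi.add_apply, add_sub_add_comm]
            exact enorm_add_le _ _
        _ = ∫⁻ θ, ‖f θ - u θ‖ₑ ∂τ + ∫⁻ θ, ‖g θ - v θ‖ₑ ∂τ :=
            lintegral_add_left (f.measurable.sub hu.measurable).enorm _
        _ ≤ ε / 2 + ε / 2 := add_le_add hu' hv'
        _ = ε := ENNReal.add_halves ε
  have hlim := SimpleFunc.tendsto_approxOn_L1_enorm (μ := τ) hf h0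
    (Eventually.of_forall fun θ => subset_closure (hfC θ)) (by simpa using hfi.2)
  obtain ⟨n, hn⟩ := (hlim.eventually_lt_const (ENNReal.half_pos hε)).exists
  set s := SimpleFunc.approxOn f hf C 0 h0 n
  obtain ⟨g, hg, hgC, hg'⟩ := hsimple s (fun θ => SimpleFunc.approxOn_mem hf h0 n θ) (ε / 2)
    (ENNReal.half_pos hε).ne'
  refine ⟨g, hg, hgC, ?_⟩
  calc ∫⁻ θ, ‖f θ - g θ‖ₑ ∂τ ≤ ∫⁻ θ, (‖s θ - f θ‖ₑ + ‖s θ - g θ‖ₑ) ∂τ := lintegral_mono fun θ => by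
        rw [← enorm_neg (s θ - f θ), neg_sub, ← sub_add_sub_cancel (f θ) (s θ) (g θ)]
        exact enorm_add_le _ _
    _ = ∫⁻ θ, ‖s θ - f θ‖ₑ ∂τ + ∫⁻ θ, ‖s θ - g θ‖ₑ ∂τ :=
        lintegral_add_left (s.measurable.sub hf).enorm _
    _ ≤ ε / 2 + ε / 2 := add_le_add hn.le hg'
    _ = ε := ENNReal.add_halves ε

end Approximation

/-! ### Continuous test functions close to a regularised inverse. -/

section TestFunctions

variable {p : ℕ}

theorem measurable_matrix_inv_apply {X : Type*} [MeasurableSpace X]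
    {N : X → Matrix (Fin p) (Fin p) ℂ} (hN : ∀ k l, Measurable fun θ => N θ k l) (k l : Fin p) :
    Measurable fun θ => (N θ)⁻¹ k l := by
  have hN' : Measurable fun θ => (fun i j => N θ i j : Fin p → Fin p → ℂ) :=
    measurable_pi_iff.2 fun i => measurable_pi_iff.2 fun j => hN i j
  have hof : Continuous fun A : Fin p → Fin p → ℂ => Matrix.of A := continuous_id
  have h1 : Continuous fun A : Fin p → Fin p → ℂ => (Matrix.of A).det := hof.matrix_det
  have h2 : Continuous fun A : Fin p → Fin p → ℂ => (Matrix.of A).adjugate k l :=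
    hof.matrix_adjugate.matrix_elem k l
  have h3 := (h1.measurable.comp hN').inv.mul (h2.measurable.comp hN')
  convert h3 using 1
  ext θ
  rw [Matrix.inv_def, Ring.inverse_eq_inv', Matrix.smul_apply, smul_eq_mul]
  rfl

/-- `M` is a positive semidefinite density with respect to `ν`, the sum of Lebesgue measure and a
measure carried by the Lebesgue null set `S`. -/
structure IsMatrixDensity (ν : Measure Angle) (M : Angle → Matrix (Fin p) (Fin p) ℂ)
    (S : Set Angle) : Prop where
  isFiniteMeasure : IsFiniteMeasure ν
  measurableSet : MeasurableSet S
  leb_eq_zero : leb S = 0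
  leb_eq : leb = ν.restrict Sᶜ
  measurable : ∀ k l, Measurable fun θ => M θ k l
  integrable : ∀ k l, Integrable (fun θ => M θ k l) ν
  posSemidef : ∀ θ, (M θ).PosSemidef

variable {ν : Measure Angle} {M : Angle → Matrix (Fin p) (Fin p) ℂ} {S : Set Angle}

theorem IsMatrixDensity.leb_le (hD : IsMatrixDensity ν M S) : leb ≤ ν := by
  conv_lhs => rw [hD.leb_eq]
  exact Measure.restrict_le_self

/-- The sum of the absolute values of the entries. -/
def entrySum (A : Matrix (Fin p) (Fin p) ℂ) : ℝ := ∑ k, ∑ l, ‖A k l‖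

theorem entrySum_nonneg (A : Matrix (Fin p) (Fin p) ℂ) : 0 ≤ entrySum A :=
  Finset.sum_nonneg fun _ _ => Finset.sum_nonneg fun _ _ => norm_nonneg _

theorem entrySum_add_le (A B : Matrix (Fin p) (Fin p) ℂ) :
    entrySum (A + B) ≤ entrySum A + entrySum B := by
  simp only [entrySum, ← Finset.sum_add_distrib]
  exact Finset.sum_le_sum fun _ _ => Finset.sum_le_sum fun _ _ => norm_add_le _ _

theorem abs_trace_re_le_entrySum (A : Matrix (Fin p) (Fin p) ℂ) : |A.trace.re| ≤ entrySum A := by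
  refine (Complex.abs_re_le_norm _).trans ((norm_sum_le _ _).trans ?_)
  exact Finset.sum_le_sum fun k _ => Finset.single_le_sum (f := fun l => ‖A k l‖)
    (fun _ _ => norm_nonneg _) (Finset.mem_univ k)

theorem abs_trace_mul_re_le (A : Matrix (Fin p) (Fin p) ℂ) {W : Matrix (Fin p) (Fin p) ℂ}
    (hW : W.PosSemidef) : |(A * W).trace.re| ≤ entrySum A * W.trace.re := by
  refine (Complex.abs_re_le_norm _).trans ?_
  rw [trace_mul_eq_sum, entrySum, Finset.sum_mul]
  refine (norm_sum_le _ _).trans (Finset.sum_le_sum fun k _ => ?_)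
  rw [Finset.sum_mul]
  refine (norm_sum_le _ _).trans (Finset.sum_le_sum fun l _ => ?_)
  rw [norm_mul]
  exact mul_le_mul_of_nonneg_left (norm_apply_le_trace hW _ _) (norm_nonneg _)

theorem integrable_trace_re {μ : Measure Angle} {N : Angle → Matrix (Fin p) (Fin p) ℂ}
    (hN : ∀ k l, Integrable (fun θ => N θ k l) μ) : Integrable (fun θ => (N θ).trace.re) μ :=
  (integrable_finsetSum _ fun i _ => hN i i : Integrable (fun θ => (N θ).trace) μ).re

theorem IsMatrixDensity.measurable_inv_add (hD : IsMatrixDensity ν M S) (δ : ℝ) (k l : Fin p) :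
    Measurable fun θ => (M θ + (δ : ℂ) • 1)⁻¹ k l :=
  measurable_matrix_inv_apply (fun i j => by
    simp only [Matrix.add_apply]
    exact (hD.measurable i j).add measurable_const) k l

/-- Continuous positive semidefinite test functions approximating `(M + δ)⁻¹` on the absolutely
continuous part and `0` on the singular part. -/
theorem IsMatrixDensity.exists_test_function (hD : IsMatrixDensity ν M S) {δ η : ℝ} (hδ : 0 < δ)
    (hη : 0 < η) : ∃ g : Angle → Matrix (Fin p) (Fin p) ℂ, Continuous g ∧ (∀ θ, (g θ).PosSemidef) ∧
      ∫ θ, (g θ * M θ).trace.re ∂ν ≤ p + η ∧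
      Integrable (fun θ => entrySum ((M θ + (δ : ℂ) • 1)⁻¹ - g θ)) leb ∧
      ∫ θ, entrySum ((M θ + (δ : ℂ) • 1)⁻¹ - g θ) ∂leb ≤ η := by
  have := hD.isFiniteMeasure
  -- The target is zero on `S`, so that the singular part adds nothing to the integral of tr(G M).
  let G : Angle → Fin p → Fin p → ℂ := Sᶜ.indicator fun θ k l => (M θ + (δ : ℂ) • 1)⁻¹ k l
  let t : Angle → ℝ := fun θ => (M θ).trace.re
  have ht0 : ∀ θ, 0 ≤ t θ := fun θ => trace_re_nonneg (hD.posSemidef θ)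
  have hti : Integrable t ν := integrable_trace_re hD.integrable
  have htm : Measurable t := by
    simp only [t, trace, diag_apply, Complex.re_sum]
    exact Finset.measurable_sum _ fun i _ => Complex.measurable_re.comp (hD.measurable i i)
  -- With the weight 1 + tr M, one approximation in mean controls both the error against M dν and
  -- the unweighted error.
  let w : Angle → ℝ≥0∞ := fun θ => ENNReal.ofReal (1 + t θ)
  have hwm : Measurable w := (measurable_const.add htm).ennreal_ofReal
  let τ := ν.withDensity w
  have hτ : IsFiniteMeasure τ :=
    isFiniteMeasure_withDensity_ofReal ((integrable_const (1 : ℝ)).add hti).2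
  have hGm : Measurable G := Measurable.indicator (measurable_pi_iff.2 fun k =>
    measurable_pi_iff.2 fun l => hD.measurable_inv_add δ k l) hD.measurableSet.compl
  have hc0 : 0 ≤ p * δ⁻¹ := by positivity
  have hGb : ∀ θ, ‖G θ‖ ≤ p * δ⁻¹ := fun θ => by
    by_cases hθ : θ ∈ S
    · simpa [G, hθ] using hc0
    · simp only [G, Set.indicator, Set.mem_compl_iff, hθ, not_false_iff, if_true]
      refine (pi_norm_le_iff_of_nonneg hc0).2 fun k => (pi_norm_le_iff_of_nonneg hc0).2 fun l => ?_
      exact (norm_apply_le_trace (inv_add_posSemidef (hD.posSemidef θ) hδ) k l).trans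
        (trace_inv_add_le (hD.posSemidef θ) hδ)
  have hGi : Integrable G τ :=
    Integrable.of_bound hGm.aestronglyMeasurable _ (Eventually.of_forall hGb)
  -- The sum of the p² entries costs a factor p²; adding 1 avoids division by zero.
  set η' : ℝ := η / (p ^ 2 + 1) with hη'
  have hη'0 : 0 < η' := by positivity
  have hη'1 : (p : ℝ) ^ 2 * η' ≤ η := by
    rw [hη', mul_div_assoc', div_le_iff₀ (by positivity)]
    nlinarith
  have hzero : (Matrix.PosSemidef (0 : Matrix (Fin p) (Fin p) ℂ)) := Matrix.PosSemidef.zero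
  obtain ⟨g, hg, hgC, hgε⟩ := exists_continuous_mem_cone
    (C := {A : Fin p → Fin p → ℂ | (Matrix.of A).PosSemidef}) hzero
    (fun x hx y hy => Matrix.PosSemidef.add hx hy)
    (fun r hr x hx => by
      have := Matrix.PosSemidef.smul (show (Matrix.of x).PosSemidef from hx)
        (a := (r : ℂ)) (by rw [Complex.zero_le_real]; exact hr)
      have e : Matrix.of (r • x) = (r : ℂ) • Matrix.of x := by
        ext i j
        simp
      exact (e ▸ this : (Matrix.of (r • x)).PosSemidef))
    hGm hGi (fun θ => by
      by_cases hθ : θ ∈ S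
      · simpa [G, hθ] using hzero
      · simp only [G, Set.indicator, Set.mem_compl_iff, hθ, not_false_iff, if_true]
        exact inv_add_posSemidef (hD.posSemidef θ) hδ)
    (ε := ENNReal.ofReal η') (by simpa using hη'0)
  have hgε : ∫⁻ θ, (w * fun θ => ‖G θ - g θ‖ₑ) θ ∂ν ≤ ENNReal.ofReal η' :=
    (lintegral_withDensity_eq_lintegral_mul ν hwm
      (hGm.sub hg.measurable).enorm).symm.le.trans hgε
  -- Used twice: with f = tr M on `ν`, and with f = 1 on `leb`.
  have hmaj : ∀ f : Angle → ℝ, (∀ θ, 0 ≤ f θ) → (∀ θ, f θ ≤ 1 + t θ) → ∀ μ : Measure Angle,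
      μ ≤ ν → AEStronglyMeasurable f μ →
      Integrable (fun θ => f θ * ‖G θ - g θ‖) μ ∧ ∫ θ, f θ * ‖G θ - g θ‖ ∂μ ≤ η' := by
    intro f hf0 hf μ hμ hfm
    have hpt : ∀ θ, ‖f θ * ‖G θ - g θ‖‖ₑ ≤ (w * fun θ => ‖G θ - g θ‖ₑ) θ := fun θ => by
      rw [enorm_mul, enorm_norm, Pi.mul_apply, Real.enorm_of_nonneg (hf0 θ)]
      exact mul_le_mul_left (ENNReal.ofReal_le_ofReal (hf θ)) _
    have hle : ∫⁻ θ, ‖f θ * ‖G θ - g θ‖‖ₑ ∂μ ≤ ENNReal.ofReal η' :=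
      ((lintegral_mono hpt).trans (lintegral_mono' hμ le_rfl)).trans hgε
    have hm : AEStronglyMeasurable (fun θ => f θ * ‖G θ - g θ‖) μ :=
      hfm.mul (hGm.sub hg.measurable).norm.aestronglyMeasurable
    refine ⟨⟨hm, hle.trans_lt ENNReal.ofReal_lt_top⟩, ?_⟩
    rw [integral_eq_lintegral_of_nonneg_ae
      (Eventually.of_forall fun θ => mul_nonneg (hf0 θ) (norm_nonneg _)) hm]
    refine ENNReal.toReal_le_of_le_ofReal hη'0.le (le_trans (le_of_eq ?_) hle)
    refine lintegral_congr fun θ => ?_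
    rw [Real.enorm_of_nonneg (mul_nonneg (hf0 θ) (norm_nonneg _))]
  have hes : ∀ A : Fin p → Fin p → ℂ, entrySum (Matrix.of A) ≤ (p : ℝ) ^ 2 * ‖A‖ := fun A => by
    calc entrySum (Matrix.of A) ≤ ∑ _k : Fin p, ∑ _l : Fin p, ‖A‖ :=
          Finset.sum_le_sum fun k _ => Finset.sum_le_sum fun l _ =>
            (norm_le_pi_norm (A k) l).trans (norm_le_pi_norm A k)
      _ = (p : ℝ) ^ 2 * ‖A‖ := by simp; ring
  have hgc : Continuous fun θ => Matrix.of (g θ) := hg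
  refine ⟨fun θ => Matrix.of (g θ), hgc, hgC, ?_, ?_⟩
  · obtain ⟨hi, hle⟩ := hmaj t ht0 (fun θ => by linarith [ht0 θ]) ν le_rfl hti.1
    have hint : Integrable (Sᶜ.indicator fun _ : Angle => (p : ℝ)) ν :=
      (integrable_const _).indicator hD.measurableSet.compl
    have hpt : ∀ θ, (Matrix.of (g θ) * M θ).trace.re ≤
        Sᶜ.indicator (fun _ => (p : ℝ)) θ + p ^ 2 * (t θ * ‖G θ - g θ‖) := fun θ => by
      have h1 : (Matrix.of (G θ) * M θ).trace.re ≤ Sᶜ.indicator (fun _ => (p : ℝ)) θ := by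
        by_cases hθ : θ ∈ S
        · simp [G, hθ]
        · simp only [G, Set.indicator, Set.mem_compl_iff, hθ, not_false_iff, if_true]
          exact trace_inv_add_mul_le (hD.posSemidef θ) hδ
      have h2 := (abs_le.1 (abs_trace_mul_re_le (Matrix.of (G θ - g θ)) (hD.posSemidef θ))).1
      have h3 : (Matrix.of (G θ - g θ) * M θ).trace.re =
          (Matrix.of (G θ) * M θ).trace.re - (Matrix.of (g θ) * M θ).trace.re := by
        rw [← Complex.sub_re, ← trace_sub, ← Matrix.sub_mul]; rfl
      have h4 := mul_le_mul_of_nonneg_right (hes (G θ - g θ)) (ht0 θ)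
      have h5 : p ^ 2 * ‖G θ - g θ‖ * t θ = p ^ 2 * (t θ * ‖G θ - g θ‖) := by ring
      simp only [t] at h4 h5 ⊢
      linarith
    calc ∫ θ, (Matrix.of (g θ) * M θ).trace.re ∂ν
        ≤ ∫ θ, (Sᶜ.indicator (fun _ => (p : ℝ)) θ + p ^ 2 * (t θ * ‖G θ - g θ‖)) ∂ν :=
          integral_mono (integrable_trace_mul hgc hD.integrable).re (hint.add (hi.const_mul _)) hpt
      _ = ∫ θ, Sᶜ.indicator (fun _ => (p : ℝ)) θ ∂ν + p ^ 2 * ∫ θ, t θ * ‖G θ - g θ‖ ∂ν := by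
          rw [integral_add hint (hi.const_mul _), integral_const_mul]
      _ ≤ p + η := by
          rw [integral_indicator hD.measurableSet.compl, ← hD.leb_eq]
          simp only [integral_const, probReal_univ, one_smul]
          nlinarith [mul_le_mul_of_nonneg_left hle (sq_nonneg (p : ℝ))]
  · obtain ⟨hi, hle⟩ := hmaj (fun _ => 1) (fun _ => zero_le_one) (fun θ => by linarith [ht0 θ]) leb
      hD.leb_le aestronglyMeasurable_const
    have hS : ∀ᵐ θ ∂leb, θ ∉ S := by rw [ae_iff]; simpa using hD.leb_eq_zero
    have hpt : ∀ᵐ θ ∂leb, entrySum ((M θ + (δ : ℂ) • 1)⁻¹ - Matrix.of (g θ)) ≤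
        p ^ 2 * (1 * ‖G θ - g θ‖) := by
      filter_upwards [hS] with θ hθ
      rw [one_mul]
      have h1 : (M θ + (δ : ℂ) • 1)⁻¹ - Matrix.of (g θ) = Matrix.of (G θ - g θ) := by
        simp only [G, Set.indicator, Set.mem_compl_iff, hθ, not_false_iff, if_true]
        rfl
      rw [h1]
      exact hes _
    have hm : Measurable fun θ => entrySum ((M θ + (δ : ℂ) • 1)⁻¹ - Matrix.of (g θ)) := by
      simp only [entrySum, Matrix.sub_apply]
      exact Finset.measurable_sum _ fun k _ => Finset.measurable_sum _ fun l _ =>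
        ((hD.measurable_inv_add δ k l).sub (hgc.matrix_elem k l).measurable).norm
    have hint : Integrable (fun θ => entrySum ((M θ + (δ : ℂ) • 1)⁻¹ - Matrix.of (g θ))) leb :=
      (hi.const_mul ((p : ℝ) ^ 2)).mono' hm.aestronglyMeasurable (by
        filter_upwards [hpt] with θ hθ
        rwa [Real.norm_of_nonneg (entrySum_nonneg _)])
    refine ⟨hint, (integral_mono_ae hint (hi.const_mul _) hpt).trans ?_⟩
    rw [integral_const_mul]
    exact (mul_le_mul_of_nonneg_left hle (sq_nonneg _)).trans hη'1

end TestFunctions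

/-! ### Nonsingular density: convergence in measure. -/

section Sufficiency

variable {p : ℕ} {ν : Measure Angle} {M : Angle → Matrix (Fin p) (Fin p) ℂ} {S : Set Angle}
  {φ : ℕ → (Matrix (Fin p) (Fin p) ℂ)[X]}

/-- The matrix `φ_n M φ_n^*`. -/
def conjWeight (φ : ℕ → (Matrix (Fin p) (Fin p) ℂ)[X]) (n : ℕ)
    (M : Angle → Matrix (Fin p) (Fin p) ℂ) (θ : Angle) : Matrix (Fin p) (Fin p) ℂ :=
  evalAt (φ n) (circlePt θ) * M θ * (evalAt (φ n) (circlePt θ))ᴴ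

theorem conjWeight_posSemidef (hpsd : ∀ θ, (M θ).PosSemidef) (n : ℕ) (θ : Angle) :
    (conjWeight φ n M θ).PosSemidef := (hpsd θ).mul_mul_conjTranspose_same _

theorem conjWeight_posDef {θ : Angle} (hM : (M θ).PosSemidef) (hdet : 0 < (M θ).det) {n : ℕ}
    (h : (evalAt (φ n) (circlePt θ)).det ≠ 0) : (conjWeight φ n M θ).PosDef := by
  have h1 : (conjWeight φ n M θ).PosSemidef := hM.mul_mul_conjTranspose_same _
  refine h1.posDef_iff_isUnit.2 ((isUnit_iff_isUnit_det _).2 (isUnit_iff_ne_zero.2 ?_))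
  rw [conjWeight, det_mul, det_mul, det_conjTranspose]
  exact mul_ne_zero (mul_ne_zero h hdet.ne') (star_ne_zero.2 h)

/-- Moves the inverse onto M, so that weak convergence of the Bernstein–Szegő weights can act. -/
theorem trace_inv_conjWeight {θ : Angle} {n : ℕ} :
    (conjWeight φ n M θ)⁻¹.trace = ((M θ)⁻¹ * bsWeight φ n θ).trace := by
  rw [conjWeight, bsWeight, Matrix.mul_inv_rev, Matrix.mul_inv_rev, trace_mul_comm,
    ← conjTranspose_nonsing_inv, Matrix.mul_assoc]

theorem tendsto_entrySum_inv_add {A : Matrix (Fin p) (Fin p) ℂ} (hA : IsUnit A.det) :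
    Tendsto (fun j : ℕ => entrySum ((A + (((1 / ((j : ℝ) + 1) : ℝ)) : ℂ) • 1)⁻¹ - A⁻¹)) atTop
      (𝓝 0) := by
  have h1 : Tendsto (fun j : ℕ => A + (((1 / ((j : ℝ) + 1) : ℝ)) : ℂ) •
      (1 : Matrix (Fin p) (Fin p) ℂ)) atTop (𝓝 A) := by
    have h2 := (Complex.continuous_ofReal.tendsto 0).comp
      (tendsto_one_div_add_atTop_nhds_zero_nat (𝕜 := ℝ))
    have h3 := (h2.smul_const (1 : Matrix (Fin p) (Fin p) ℂ)).const_add A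
    simpa using h3
  have hinv : ContinuousAt (fun B : Matrix (Fin p) (Fin p) ℂ => B⁻¹) A := by
    simp only [Matrix.inv_def, Ring.inverse_eq_inv']
    exact (continuous_id.matrix_det.continuousAt.inv₀ (isUnit_iff_ne_zero.1 hA)).smul
      continuous_id.matrix_adjugate.continuousAt
  have hes : Continuous fun B : Matrix (Fin p) (Fin p) ℂ => entrySum B := by
    unfold entrySum
    exact continuous_finsetSum _ fun k _ => continuous_finsetSum _ fun l _ =>
      (continuous_id.matrix_elem k l).norm
  have h4 := (hinv.tendsto.comp h1).sub_const (A⁻¹)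
  have h5 := (hes.tendsto _).comp h4
  have h6 : entrySum (A⁻¹ - A⁻¹) = 0 := by simp [entrySum]
  rw [h6] at h5
  exact h5

/-- M⁻¹ need not be integrable, so it is reached in two stages: (M + δ)⁻¹ tends to it in measure as
δ → 0, and g is close to (M + δ)⁻¹ in mean. Each stage costs an exceptional set of measure at most
r. -/
theorem IsMatrixDensity.exists_test_function_near_inv (hD : IsMatrixDensity ν M S)
    (hdet : ∀ᵐ θ ∂leb, 0 < (M θ).det) {r : ℝ} (hr : 0 < r) :
    ∃ (g : Angle → Matrix (Fin p) (Fin p) ℂ) (E : Set Angle), Continuous g ∧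
      (∀ θ, (g θ).PosSemidef) ∧ ∫ θ, (g θ * M θ).trace.re ∂ν ≤ p + r ∧ MeasurableSet E ∧
      leb.real E ≤ 2 * r ∧ ∀ θ ∉ E, entrySum ((M θ)⁻¹ - g θ) ≤ 2 * r := by
  have hmeasD : ∀ δ : ℝ, Measurable fun θ => entrySum ((M θ + (δ : ℂ) • 1)⁻¹ - (M θ)⁻¹) :=
    fun δ => by
      simp only [entrySum, Matrix.sub_apply]
      exact Finset.measurable_sum _ fun k _ => Finset.measurable_sum _ fun l _ =>
        ((hD.measurable_inv_add δ k l).sub (measurable_matrix_inv_apply hD.measurable k l)).norm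
  have hae : ∀ᵐ θ ∂leb, Tendsto (fun j : ℕ =>
      entrySum ((M θ + (((1 / ((j : ℝ) + 1) : ℝ)) : ℂ) • 1)⁻¹ - (M θ)⁻¹)) atTop (𝓝 0) := by
    filter_upwards [hdet] with θ hθ
    exact tendsto_entrySum_inv_add (isUnit_iff_ne_zero.2 hθ.ne')
  have hTM := tendstoInMeasure_of_tendsto_ae (fun j : ℕ => (hmeasD _).aestronglyMeasurable) hae
  rw [tendstoInMeasure_iff_norm] at hTM
  obtain ⟨j, hj⟩ := ((hTM r hr).eventually_le_const (ENNReal.ofReal_pos.2 hr)).exists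
  set δ : ℝ := 1 / ((j : ℝ) + 1) with hδ
  have hδ0 : 0 < δ := by positivity
  obtain ⟨g, hg, hgp, hgM, hgi, hgle⟩ := hD.exists_test_function hδ0
    -- The bound r serves the integral of tr(g M); the bound r² gives, by Chebyshev at level r, a
    -- set of measure at most r.
    (η := min r (r ^ 2)) (lt_min hr (by positivity))
  let H : Angle → ℝ := fun θ => entrySum ((M θ + (δ : ℂ) • 1)⁻¹ - g θ)
  let D : Angle → ℝ := fun θ => entrySum ((M θ + (δ : ℂ) • 1)⁻¹ - (M θ)⁻¹)
  have hHm : Measurable H := by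
    simp only [H, entrySum, Matrix.sub_apply]
    exact Finset.measurable_sum _ fun k _ => Finset.measurable_sum _ fun l _ =>
      ((hD.measurable_inv_add δ k l).sub (hg.matrix_elem k l).measurable).norm
  refine ⟨g, {θ | r ≤ D θ} ∪ {θ | r ≤ H θ}, hg, hgp, hgM.trans (by gcongr; exact min_le_left _ _),
    (measurableSet_le measurable_const (hmeasD δ)).union (measurableSet_le measurable_const hHm),
    ?_, fun θ hθ => ?_⟩
  · refine (measureReal_union_le _ _).trans ?_
    have h1 : leb.real {θ | r ≤ D θ} ≤ r := by
      refine ENNReal.toReal_le_of_le_ofReal hr.le (le_trans (measure_mono fun θ hθ => ?_) hj)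
      simp only [Set.mem_ofPred_eq, sub_zero] at hθ ⊢
      rwa [Real.norm_of_nonneg (entrySum_nonneg _)]
    have h2 : leb.real {θ | r ≤ H θ} ≤ r := by
      have h3 := mul_meas_ge_le_integral_of_nonneg
        (Eventually.of_forall fun θ => entrySum_nonneg _) hgi r
      have h4 : r * leb.real {θ | r ≤ H θ} ≤ r * r :=
        h3.trans (hgle.trans ((min_le_right _ _).trans (by rw [sq])))
      exact le_of_mul_le_mul_left h4 hr
    linarith
  · simp only [Set.mem_union, Set.mem_ofPred_eq, not_or, not_le] at hθ
    have h1 : (M θ)⁻¹ - g θ = ((M θ)⁻¹ - (M θ + (δ : ℂ) • 1)⁻¹) +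
        ((M θ + (δ : ℂ) • 1)⁻¹ - g θ) := by abel
    have h2 : entrySum ((M θ)⁻¹ - (M θ + (δ : ℂ) • 1)⁻¹) = D θ := by
      simp only [D, entrySum, Matrix.sub_apply]
      exact Finset.sum_congr rfl fun k _ => Finset.sum_congr rfl fun l _ => norm_sub_rev _ _
    rw [h1]
    refine (entrySum_add_le _ _).trans ?_
    rw [h2]
    linarith [hθ.1, hθ.2]

/-- If the density is nonsingular almost everywhere, then `φ_n M φ_n^*` tends to the identity in
measure. -/
theorem eventually_measure_trace_add_inv_le (hD : IsMatrixDensity ν M S)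
    (hφ : IsOrthonormalFor (intForm ν M hD.integrable) φ)
    (hdetφ : ∀ n θ, (evalAt (φ n) (circlePt θ)).det ≠ 0)
    (hdet : ∀ᵐ θ ∂leb, 0 < (M θ).det) {ε : ℝ} (hε : 0 < ε) :
    ∀ᶠ n in atTop, leb.real {θ | 2 * p + ε <
      (conjWeight φ n M θ).trace.re + (conjWeight φ n M θ)⁻¹.trace.re} ≤ ε := by
  have hW := fun n => continuous_bsWeight (hdetφ n)
  have hWi : ∀ n k l, Integrable (fun θ => bsWeight φ n θ k l) leb := fun n k l =>
    integrable_of_continuous ((hW n).matrix_elem k l)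
  set c : ℝ := (∫ θ, (M θ).trace ∂ν).re with hc
  have hcW : ∀ n, ∫ θ, (bsWeight φ n θ).trace.re ∂leb = c := fun n => by
    have h1 : ∫ θ, (bsWeight φ n θ).trace.re ∂leb = (∫ θ, (bsWeight φ n θ).trace ∂leb).re :=
      integral_re (integrable_of_continuous (hW n).matrix_trace)
    rw [h1, integral_trace_bsWeight hD.integrable hD.posSemidef hφ n (hW n)]
  have hc0 : 0 ≤ c := by
    rw [← hcW 0]
    exact integral_nonneg fun θ => trace_re_nonneg (bsWeight_posSemidef φ 0 θ)
  -- K collects the error terms in units of r: 2 from the integral of tr(g W_n), 2c from replacing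
  -- M⁻¹ by g, and 4p from the set `E`. Then r is chosen so that 2r + rK/ε = ε.
  set K : ℝ := 2 + 2 * c + 4 * p with hK
  have hK0 : 0 < K := by positivity
  set r : ℝ := ε / (2 + K / ε) with hr'
  have hr : 0 < r := by positivity
  have hrK : 2 * r + r * K / ε ≤ ε := by
    have : 2 * r + r * K / ε = r * (2 + K / ε) := by ring
    rw [this, hr', div_mul_cancel₀ _ (by positivity)]
  obtain ⟨g, E, hg, hgp, hgM, hE, hEle, hgE⟩ := hD.exists_test_function_near_inv hdet hr
  have hlim := tendsto_integral_trace_mul_bsWeight hD.integrable hD.posSemidef hφ hW hg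
  filter_upwards [hlim.eventually_lt_const (lt_add_of_pos_right _ hr)] with n hn
  have hBint : Integrable (fun θ => (conjWeight φ n M θ).trace.re) ν :=
    (integrable_trace_conj hD.integrable (φ n)).re
  have hBle : ∫ θ, (conjWeight φ n M θ).trace.re ∂leb ≤ p := by
    have h1 : ∫ θ, (conjWeight φ n M θ).trace.re ∂ν = p := by
      have h2 : ∫ θ, (conjWeight φ n M θ).trace.re ∂ν = (∫ θ, (conjWeight φ n M θ).trace ∂ν).re :=
        integral_re (integrable_trace_conj hD.integrable (φ n))
      rw [h2]
      simp only [conjWeight]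
      rw [integral_trace_conj hD.integrable hφ n]
      simp
    rw [← h1]
    -- The singular part can only add to the total p.
    exact integral_mono_measure hD.leb_le (Eventually.of_forall fun θ =>
      trace_re_nonneg (conjWeight_posSemidef hD.posSemidef n θ)) hBint
  have hBint' : Integrable (fun θ => (conjWeight φ n M θ).trace.re) leb :=
    hBint.mono_measure hD.leb_le
  have hgW : Integrable (fun θ => (g θ * bsWeight φ n θ).trace.re) leb :=
    (integrable_trace_mul hg (hWi n)).re
  have hWt : Integrable (fun θ => (bsWeight φ n θ).trace.re) leb := integrable_trace_re (hWi n)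
  have hEi : Integrable (E.indicator fun _ : Angle => (2 * p : ℝ)) leb :=
    (integrable_const _).indicator hE
  -- Off `E` this majorizes tr B + tr B⁻¹ - 2p ≥ 0; on `E` the indicator cancels -2p. So s ≥ 0
  -- almost everywhere, as Chebyshev's inequality requires.
  let s : Angle → ℝ := fun θ => (conjWeight φ n M θ).trace.re + (g θ * bsWeight φ n θ).trace.re +
    2 * r * (bsWeight φ n θ).trace.re - 2 * p + E.indicator (fun _ => (2 * p : ℝ)) θ
  have hsi : Integrable s leb :=
    (((hBint'.add hgW).add (hWt.const_mul _)).sub (integrable_const _)).add hEi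
  have hsle : ∫ θ, s θ ∂leb ≤ r * K := by
    have e : ∫ θ, s θ ∂leb = ∫ θ, (conjWeight φ n M θ).trace.re ∂leb +
        ∫ θ, (g θ * bsWeight φ n θ).trace.re ∂leb + 2 * r * c - 2 * p + leb.real E * (2 * p) := by
      have i1 := integral_add' hBint' hgW
      have i2 := integral_add' (hBint'.add hgW) (hWt.const_mul (2 * r))
      have i3 := integral_sub' ((hBint'.add hgW).add (hWt.const_mul (2 * r)))
        (integrable_const (2 * p : ℝ))
      have i4 := integral_add' (((hBint'.add hgW).add (hWt.const_mul (2 * r))).sub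
        (integrable_const (2 * p : ℝ))) hEi
      rw [i3, i2, i1, integral_const_mul, hcW, integral_indicator hE] at i4
      refine Eq.trans i4 ?_
      simp
    have h2 : leb.real E * (2 * p) ≤ 2 * r * (2 * p) :=
      mul_le_mul_of_nonneg_right hEle (by positivity)
    rw [e, hK]
    nlinarith
  have hts : ∀ θ ∉ E, (conjWeight φ n M θ).trace.re + (conjWeight φ n M θ)⁻¹.trace.re - 2 * p ≤
      s θ := fun θ hθ => by
    have h1 := (abs_le.1 (abs_trace_mul_re_le ((M θ)⁻¹ - g θ) (bsWeight_posSemidef φ n θ))).2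
    have h2 : (((M θ)⁻¹ - g θ) * bsWeight φ n θ).trace.re =
        (conjWeight φ n M θ)⁻¹.trace.re - (g θ * bsWeight φ n θ).trace.re := by
      rw [trace_inv_conjWeight, Matrix.sub_mul, trace_sub, Complex.sub_re]
    have h3 := mul_le_mul_of_nonneg_right (hgE θ hθ) (trace_re_nonneg (bsWeight_posSemidef φ n θ))
    simp only [s, Set.indicator_of_notMem hθ]
    linarith
  have hs0 : ∀ᵐ θ ∂leb, 0 ≤ s θ := by
    filter_upwards [hdet] with θ hθ
    by_cases hE' : θ ∈ E
    · have h1 := trace_re_nonneg (conjWeight_posSemidef (φ := φ) hD.posSemidef n θ)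
      have h2 := trace_mul_re_nonneg (hgp θ) (bsWeight_posSemidef φ n θ)
      have h3 := mul_nonneg hr.le (trace_re_nonneg (bsWeight_posSemidef φ n θ))
      simp only [s, Set.indicator_of_mem hE']
      linarith
    · have h1 := two_mul_le_trace_add_inv (conjWeight_posDef (hD.posSemidef θ) hθ (hdetφ n θ))
      linarith [hts θ hE']
  have hmark := mul_meas_ge_le_integral_of_nonneg hs0 hsi ε
  have h5 : leb.real {θ | ε ≤ s θ} ≤ r * K / ε := by
    rw [le_div_iff₀ hε, mul_comm]
    exact hmark.trans hsle
  refine le_trans ?_ hrK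
  refine (measureReal_mono (s₂ := E ∪ {θ | ε ≤ s θ}) fun θ hθ => ?_).trans
    ((measureReal_union_le _ _).trans (add_le_add hEle h5))
  by_cases hE' : θ ∈ E
  · exact Or.inl hE'
  · refine Or.inr ?_
    have := hts θ hE'
    simp only [Set.mem_ofPred_eq] at hθ ⊢
    linarith

end Sufficiency

/-! ### Nonsingular density: convergence in mean. -/

section Sufficiency

variable {p : ℕ} {ν : Measure Angle} {M : Angle → Matrix (Fin p) (Fin p) ℂ} {S : Set Angle}
  {φ : ℕ → (Matrix (Fin p) (Fin p) ℂ)[X]}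

theorem ratioDefect_eq (φ : ℕ → (Matrix (Fin p) (Fin p) ℂ)[X]) (n m : ℕ) (θ : Angle) :
    ratioDefect φ n m θ = conjWeight φ n (bsWeight φ m) θ - 1 := by
  simp only [ratioDefect, conjWeight, bsWeight, conjTranspose_nonsing_inv, Matrix.mul_assoc]

open scoped Matrix.Norms.L2Operator in
theorem specNorm_nonneg (A : Matrix (Fin p) (Fin p) ℂ) : 0 ≤ specNorm A := by
  exact norm_nonneg A

theorem integral_trace_re_conjWeight_bsWeight (hD : IsMatrixDensity ν M S)
    (hφ : IsOrthonormalFor (intForm ν M hD.integrable) φ)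
    (hdetφ : ∀ n θ, (evalAt (φ n) (circlePt θ)).det ≠ 0) {n m : ℕ} (hnm : n ≤ m) :
    Integrable (fun θ => (conjWeight φ n (bsWeight φ m) θ).trace.re) leb ∧
      ∫ θ, (conjWeight φ n (bsWeight φ m) θ).trace.re ∂leb = p := by
  have hW := continuous_bsWeight (hdetφ m)
  have hi : Integrable (fun θ => (conjWeight φ n (bsWeight φ m) θ).trace) leb :=
    integrable_trace_conj (fun k l => integrable_of_continuous (hW.matrix_elem k l)) (φ n)
  refine ⟨hi.re, ?_⟩
  have h2 : ∫ θ, (conjWeight φ n (bsWeight φ m) θ).trace.re ∂leb =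
      (∫ θ, (conjWeight φ n (bsWeight φ m) θ).trace ∂leb).re := integral_re hi
  rw [h2]
  simp only [conjWeight]
  rw [integral_trace_conj_bsWeight hD.integrable hD.posSemidef hφ hnm hW]
  simp

/-- A one-sided bound is enough because the trace has mean exactly p. Off `T` the norm is at most tr
A - rp + (1 - r); on `T` the same bound with r = 0 is used. In the mean the p cancels. -/
theorem lintegral_specNorm_ratioDefect_le (hD : IsMatrixDensity ν M S)
    (hφ : IsOrthonormalFor (intForm ν M hD.integrable) φ)
    (hdetφ : ∀ n θ, (evalAt (φ n) (circlePt θ)).det ≠ 0) {n m : ℕ} (hnm : n ≤ m) {r : ℝ}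
    (hr1 : r ≤ 1) {T : Set Angle} (hT : MeasurableSet T)
    (h : ∀ᵐ θ ∂leb, θ ∉ T → (conjWeight φ n (bsWeight φ m) θ - (r : ℂ) • 1).PosSemidef) :
    ∫⁻ θ, ENNReal.ofReal (specNorm (ratioDefect φ n m θ)) ∂leb ≤
      ENNReal.ofReal ((p + 1) * (1 - r + leb.real T)) := by
  obtain ⟨hAi, hA⟩ := integral_trace_re_conjWeight_bsWeight hD hφ hdetφ hnm
  set f : Angle → ℝ := (fun θ => (conjWeight φ n (bsWeight φ m) θ).trace.re) +
    ((fun _ => (p + 1) * (1 - r) - p) + T.indicator fun _ => (p + 1) * r) with hf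
  have hTi : Integrable (T.indicator fun _ : Angle => ((p + 1) * r : ℝ)) leb :=
    (integrable_const _).indicator hT
  have hci : Integrable (fun _ : Angle => ((p + 1) * (1 - r) - p : ℝ)) leb := integrable_const _
  have hfi : Integrable f leb := hAi.add (hci.add hTi)
  have hfle : ∫ θ, f θ ∂leb ≤ (p + 1) * (1 - r + leb.real T) := by
    rw [hf, integral_add' hAi (hci.add hTi), integral_add' hci hTi, hA, integral_indicator hT]
    simp only [integral_const, probReal_univ, measureReal_restrict_apply_univ, smul_eq_mul]
    nlinarith [mul_le_mul_of_nonneg_left hr1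
      (mul_nonneg (measureReal_nonneg (μ := leb) (s := T)) (by positivity : (0 : ℝ) ≤ p + 1))]
  have hae : ∀ᵐ θ ∂leb, specNorm (ratioDefect φ n m θ) ≤ f θ := by
    filter_upwards [h] with θ hθ
    rw [ratioDefect_eq]
    by_cases hθT : θ ∈ T
    · have h0 := conjWeight_posSemidef (φ := φ) (bsWeight_posSemidef φ m) n θ
      have h1 := specNorm_sub_one_le (A := conjWeight φ n (bsWeight φ m) θ) (r := 0) zero_le_one
        (by simpa using h0)
      simp only [hf, Pi.add_apply, Set.indicator_of_mem hθT]
      linarith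
    · have h1 := specNorm_sub_one_le hr1 (hθ hθT)
      simp only [hf, Pi.add_apply, Set.indicator_of_notMem hθT]
      linarith
  refine (lintegral_mono_ae (hae.mono fun θ hθ => ENNReal.ofReal_le_ofReal hθ)).trans ?_
  rw [← ofReal_integral_eq_lintegral_ofReal hfi
    (hae.mono fun θ hθ => (specNorm_nonneg _).trans hθ)]
  exact ENNReal.ofReal_le_ofReal hfle

/-- If the density is nonsingular almost everywhere, the ratios converge in the mean to the
identity. -/
theorem tendsto_iSup_lintegral_ratioDefect (hD : IsMatrixDensity ν M S)
    (hφ : IsOrthonormalFor (intForm ν M hD.integrable) φ)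
    (hdetφ : ∀ n θ, (evalAt (φ n) (circlePt θ)).det ≠ 0)
    (hdet : ∀ᵐ θ ∂leb, 0 < (M θ).det) :
    Tendsto (fun n : ℕ => ⨆ (ℓ : ℕ) (_ : 1 ≤ ℓ),
      ∫⁻ θ, ENNReal.ofReal (specNorm (ratioDefect φ n (n + ℓ) θ)) ∂leb) atTop (𝓝 0) := by
  rw [ENNReal.tendsto_nhds_zero]
  intro η hη
  obtain ⟨η', hη'0, hη'⟩ : ∃ η' : ℝ, 0 < η' ∧ ENNReal.ofReal η' ≤ η := by
    rcases eq_or_ne η ⊤ with rfl | hη'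
    · exact ⟨1, one_pos, le_top⟩
    · exact ⟨η.toReal, ENNReal.toReal_pos hη.ne' hη', ENNReal.ofReal_toReal_le⟩
  set s : ℝ := min 1 (η' / (3 * (p + 1))) with hs
  have hs0 : 0 < s := lt_min one_pos (by positivity)
  have hs1 : s ≤ 1 := min_le_left _ _
  have hsη : (p + 1) * (3 * s) ≤ η' := by
    have := (le_div_iff₀ (by positivity)).1 (min_le_right 1 (η' / (3 * (p + 1))))
    linarith
  -- As ε ≤ 1, ε(2 + ε) ≤ 3ε = s². The final error is (p + 1) times at most 2s from the lower bound
  -- plus 2ε ≤ s from the exceptional set, which is the 3 in the choice of s.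
  set ε : ℝ := s ^ 2 / 3 with hε
  have hε0 : 0 < ε := by positivity
  have hss : s ^ 2 ≤ s := by nlinarith
  have hεs : ε * (2 + ε) ≤ s ^ 2 := by
    have : ε ≤ 1 := by rw [hε]; linarith
    nlinarith
  obtain ⟨N, hN⟩ := eventually_atTop.1 (eventually_measure_trace_add_inv_le hD hφ hdetφ hdet hε0)
  filter_upwards [eventually_ge_atTop N] with n hn
  refine iSup₂_le fun ℓ _ => le_trans ?_ hη'
  set B : ℕ → Set Angle := fun k => {θ | 2 * p + ε <
      (conjWeight φ k M θ).trace.re + (conjWeight φ k M θ)⁻¹.trace.re} with hB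
  set T := toMeasurable leb (B n ∪ B (n + ℓ)) with hT
  have hTle : leb.real T ≤ 2 * ε := by
    rw [Measure.real, hT, measure_toMeasurable]
    refine (measureReal_union_le _ _).trans ?_
    linarith [hN n hn, hN (n + ℓ) (by omega)]
  have hr2 : 1 - (1 - s) / (1 + s) ≤ 2 * s := by
    rw [sub_le_iff_le_add, ← sub_le_iff_le_add', le_div_iff₀ (by linarith)]
    nlinarith
  have hr1 : (1 - s) / (1 + s) ≤ 1 := by
    rw [div_le_one (by linarith)]
    linarith
  refine (lintegral_specNorm_ratioDefect_le hD hφ hdetφ (Nat.le_add_right n ℓ) hr1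
    (T := T) (measurableSet_toMeasurable _ _) ?_).trans (ENNReal.ofReal_le_ofReal (le_trans ?_ hsη))
  · filter_upwards [hdet] with θ hθ hθT
    have hθB : θ ∉ B n ∪ B (n + ℓ) := fun h => hθT (subset_toMeasurable _ _ h)
    simp only [hB, Set.mem_union, Set.mem_ofPred_eq, not_or, not_lt] at hθB
    have hpd := fun k => conjWeight_posDef (hD.posSemidef θ) hθ (hdetφ k θ)
    exact sub_smul_posSemidef_of_near (isUnit_iff_ne_zero.2 (hdetφ (n + ℓ) θ)) hs0.le
      (near_one_of_trace_add_inv (hpd n) hs0.le hεs hθB.1).1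
      (near_one_of_trace_add_inv (hpd (n + ℓ)) hs0.le hεs hθB.2).2
  · refine mul_le_mul_of_nonneg_left ?_ (by positivity)
    linarith

end Sufficiency

/-! ### Convergence in mean forces a nonsingular density. -/

section Necessity

variable {p : ℕ} {ν : Measure Angle} {M : Angle → Matrix (Fin p) (Fin p) ℂ} {S : Set Angle}
  {φ : ℕ → (Matrix (Fin p) (Fin p) ℂ)[X]}

/-- Put Y = Q⁻¹ᴴ g Q⁻¹. Then tr g = tr(Y QQᴴ) ≤ tr Y · tr(QQᴴ), and pairing Y with the assumed lower
bound gives tr Y ≤ 2 tr(gW). -/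
theorem trace_re_le_of_half_le_conj {Q W g : Matrix (Fin p) (Fin p) ℂ} (hQ : IsUnit Q.det)
    (hg : g.PosSemidef) (h : (Q * W * Qᴴ - ((1 / 2 : ℝ) : ℂ) • 1).PosSemidef) :
    g.trace.re ≤ 2 * (Q * Qᴴ).trace.re * (g * W).trace.re := by
  have hY : (Q⁻¹ᴴ * g * Q⁻¹).PosSemidef := hg.conjTranspose_mul_mul_same _
  have hQ1 : Q⁻¹ * Q = 1 := nonsing_inv_mul _ hQ
  have hQ2 : Qᴴ * Q⁻¹ᴴ = 1 := by rw [← conjTranspose_mul, hQ1, conjTranspose_one]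
  have e1 : (Q⁻¹ᴴ * g * Q⁻¹ * (Q * Qᴴ)).trace = g.trace := by
    rw [show Q⁻¹ᴴ * g * Q⁻¹ * (Q * Qᴴ) = Q⁻¹ᴴ * g * (Q⁻¹ * Q) * Qᴴ by simp only [Matrix.mul_assoc],
      hQ1, Matrix.mul_one, trace_mul_comm, ← Matrix.mul_assoc, hQ2, Matrix.one_mul]
  have e2 : (Q⁻¹ᴴ * g * Q⁻¹ * (Q * W * Qᴴ)).trace = (g * W).trace := by
    rw [show Q⁻¹ᴴ * g * Q⁻¹ * (Q * W * Qᴴ) = Q⁻¹ᴴ * g * (Q⁻¹ * Q) * W * Qᴴ by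
        simp only [Matrix.mul_assoc],
      hQ1, Matrix.mul_one, trace_mul_comm, ← Matrix.mul_assoc, ← Matrix.mul_assoc, hQ2,
      Matrix.one_mul]
  have h1 := trace_mul_re_le hY (posSemidef_self_mul_conjTranspose Q)
  have h2 := trace_mul_re_nonneg hY h
  rw [Matrix.mul_sub, trace_sub, e2, Matrix.mul_smul, Matrix.mul_one, trace_smul, Complex.sub_re,
    smul_eq_mul, Complex.re_ofReal_mul] at h2
  rw [e1] at h1
  have h3 := trace_re_nonneg (posSemidef_self_mul_conjTranspose Q)
  nlinarith [mul_le_mul_of_nonneg_right (by linarith :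
    (Q⁻¹ᴴ * g * Q⁻¹).trace.re ≤ 2 * (g * W).trace.re) h3]

open scoped Matrix.Norms.L2Operator in
theorem continuous_specNorm : Continuous (specNorm (p := p)) :=
  (continuous_norm : Continuous fun A : Matrix (Fin p) (Fin p) ℂ => ‖A‖)

theorem continuous_specNorm_ratioDefect
    (hdetφ : ∀ n θ, (evalAt (φ n) (circlePt θ)).det ≠ 0) (n m : ℕ) :
    Continuous fun θ => specNorm (ratioDefect φ n m θ) := by
  refine continuous_specNorm.comp ?_
  rw [show ratioDefect φ n m = fun θ => conjWeight φ n (bsWeight φ m) θ - 1 from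
    funext (ratioDefect_eq φ n m)]
  exact (((continuous_evalAt (φ n)).matrix_mul (continuous_bsWeight (hdetφ m))).matrix_mul
    (continuous_evalAt (φ n)).matrix_conjTranspose).sub continuous_const

theorem measureReal_half_lt_specNorm_le
    (hdetφ : ∀ n θ, (evalAt (φ n) (circlePt θ)).det ≠ 0) {n m : ℕ} {ε : ℝ} (hε : 0 ≤ ε)
    (h : ∫⁻ θ, ENNReal.ofReal (specNorm (ratioDefect φ n m θ)) ∂leb ≤ ENNReal.ofReal ε) :
    leb.real {θ | 1 / 2 ≤ specNorm (ratioDefect φ n m θ)} ≤ 2 * ε := by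
  have h1 := mul_meas_ge_le_lintegral (μ := leb)
    (continuous_specNorm_ratioDefect hdetφ n m).measurable.ennreal_ofReal (ENNReal.ofReal (1 / 2))
  have h2 := ENNReal.toReal_mono ENNReal.ofReal_ne_top (h1.trans h)
  rw [ENNReal.toReal_mul, ENNReal.toReal_ofReal (by norm_num), ENNReal.toReal_ofReal hε] at h2
  have h3 : leb.real {θ | 1 / 2 ≤ specNorm (ratioDefect φ n m θ)} ≤
      (leb {θ | ENNReal.ofReal (1 / 2) ≤ ENNReal.ofReal (specNorm (ratioDefect φ n m θ))}).toReal :=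
    measureReal_mono fun θ hθ => ENNReal.ofReal_le_ofReal hθ
  linarith

/-- With n fixed, tr(φ_n φ_n^*) is bounded on the circle. A point with det M = 0 either has defect
at least 1/2, on a set of measure at most 2ε, or makes u at least δ⁻¹, although u has integral at
most C independent of δ. -/
theorem measureReal_not_det_pos_le (hD : IsMatrixDensity ν M S)
    (hφ : IsOrthonormalFor (intForm ν M hD.integrable) φ)
    (hdetφ : ∀ n θ, (evalAt (φ n) (circlePt θ)).det ≠ 0) {n : ℕ} {ε : ℝ} (hε : 0 ≤ ε)
    (h : ∀ m, n < m →
      ∫⁻ θ, ENNReal.ofReal (specNorm (ratioDefect φ n m θ)) ∂leb ≤ ENNReal.ofReal ε) :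
    leb.real {θ | ¬ 0 < (M θ).det} ≤ 2 * ε := by
  obtain ⟨K, hK⟩ : ∃ K : ℝ, ∀ θ : Angle,
      (evalAt (φ n) (circlePt θ) * (evalAt (φ n) (circlePt θ))ᴴ).trace.re ≤ K := by
    have hc : Continuous fun θ : Angle =>
        (evalAt (φ n) (circlePt θ) * (evalAt (φ n) (circlePt θ))ᴴ).trace.re :=
      Complex.continuous_re.comp ((continuous_evalAt (φ n)).matrix_mul
        (continuous_evalAt (φ n)).matrix_conjTranspose).matrix_trace
    obtain ⟨K, hK⟩ := isCompact_univ.exists_bound_of_continuousOn hc.continuousOn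
    exact ⟨K, fun θ => (le_abs_self _).trans (hK θ trivial)⟩
  have hK0 : 0 ≤ K := (trace_re_nonneg (posSemidef_self_mul_conjTranspose _)).trans (hK 0)
  set C : ℝ := 2 * K * (p + 2) + 1 with hC
  have hC0 : 0 < C := by positivity
  have key : ∀ δ : ℝ, 0 < δ → leb.real {θ | ¬ 0 < (M θ).det} ≤ 2 * ε + δ * C := by
    intro δ hδ
    obtain ⟨g, hg, hgp, hgM, hHi, hH⟩ := hD.exists_test_function hδ one_pos
    have hW := fun k => continuous_bsWeight (hdetφ k)
    have hlim := tendsto_integral_trace_mul_bsWeight hD.integrable hD.posSemidef hφ hW hg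
    -- The index m depends on g, hence on δ, so smallness for all m > n, supplied by the supremum
    -- over ℓ, is essential.
    obtain ⟨m, hm, hnm⟩ := ((hlim.eventually_lt_const
      (show _ < (p : ℝ) + 2 by linarith)).and (eventually_gt_atTop n)).exists
    have hgW : Integrable (fun θ => (g θ * bsWeight φ m θ).trace.re) leb :=
      (integrable_trace_mul hg fun k l => integrable_of_continuous ((hW m).matrix_elem k l)).re
    set H : Angle → ℝ := fun θ => entrySum ((M θ + (δ : ℂ) • 1)⁻¹ - g θ) with hHdef
    set u : Angle → ℝ := (fun θ => 2 * K * (g θ * bsWeight φ m θ).trace.re) + H with hu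
    have hui : Integrable u leb := (hgW.const_mul _).add hHi
    have hu0 : ∀ θ, 0 ≤ u θ := fun θ =>
      add_nonneg (mul_nonneg (by positivity)
        (trace_mul_re_nonneg (hgp θ) (bsWeight_posSemidef φ m θ))) (entrySum_nonneg _)
    have huC : ∫ θ, u θ ∂leb ≤ C := by
      rw [hu, integral_add' (hgW.const_mul _) hHi, integral_const_mul, hC]
      exact add_le_add (mul_le_mul_of_nonneg_left hm.le (by positivity)) hH
    have h1 := mul_meas_ge_le_integral_of_nonneg (Eventually.of_forall hu0) hui δ⁻¹
    have h2 : leb.real {θ | δ⁻¹ ≤ u θ} ≤ δ * C := by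
      have h3 := mul_le_mul_of_nonneg_left (h1.trans huC) hδ.le
      rwa [← mul_assoc, mul_inv_cancel₀ hδ.ne', one_mul] at h3
    refine (measureReal_mono (s₂ := {θ | 1 / 2 ≤ specNorm (ratioDefect φ n m θ)} ∪
      {θ | δ⁻¹ ≤ u θ}) fun θ hθ => ?_).trans ((measureReal_union_le _ _).trans
        (add_le_add (measureReal_half_lt_specNorm_le hdetφ hε (h m hnm)) h2))
    by_cases hs : 1 / 2 ≤ specNorm (ratioDefect φ n m θ)
    · exact Or.inl hs
    refine Or.inr ?_
    have hdet0 : (M θ).det = 0 := by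
      by_contra h0
      exact hθ (lt_of_le_of_ne (hD.posSemidef θ).det_nonneg (Ne.symm h0))
    -- The chain is δ⁻¹ ≤ tr (M + δ)⁻¹ ≤ tr g + H ≤ 2K tr(g W_m) + H = u.
    have h3 := inv_le_trace_inv_add (hD.posSemidef θ) hδ hdet0
    have h4 := (abs_le.1 (abs_trace_re_le_entrySum ((M θ + (δ : ℂ) • 1)⁻¹ - g θ))).2
    rw [trace_sub, Complex.sub_re] at h4
    rw [ratioDefect_eq] at hs
    have h5 := sub_half_posSemidef
      (conjWeight_posSemidef (φ := φ) (bsWeight_posSemidef φ m) n θ).isHermitian (not_le.1 hs).le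
    have h6 := trace_re_le_of_half_le_conj (isUnit_iff_ne_zero.2 (hdetφ n θ)) (hgp θ) h5
    have h7 := mul_le_mul_of_nonneg_right (mul_le_mul_of_nonneg_left (hK θ) zero_le_two)
      (trace_mul_re_nonneg (hgp θ) (bsWeight_posSemidef φ m θ))
    simp only [Set.mem_ofPred_eq, hu, hHdef, Pi.add_apply]
    linarith
  refine le_of_forall_pos_le_add fun t ht => ?_
  have := key (t / C) (by positivity)
  rwa [div_mul_cancel₀ _ hC0.ne'] at this

/-- If the ratios converge in the mean to the identity, the density is nonsingular almost
everywhere. -/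
theorem ae_det_pos_of_tendsto (hD : IsMatrixDensity ν M S)
    (hφ : IsOrthonormalFor (intForm ν M hD.integrable) φ)
    (hdetφ : ∀ n θ, (evalAt (φ n) (circlePt θ)).det ≠ 0)
    (hlim : Tendsto (fun n : ℕ => ⨆ (ℓ : ℕ) (_ : 1 ≤ ℓ),
      ∫⁻ θ, ENNReal.ofReal (specNorm (ratioDefect φ n (n + ℓ) θ)) ∂leb) atTop (𝓝 0)) :
    ∀ᵐ θ ∂leb, 0 < (M θ).det := by
  have hle : leb.real {θ | ¬ 0 < (M θ).det} ≤ 0 := by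
    refine le_of_forall_pos_le_add fun t ht => ?_
    obtain ⟨n, hn⟩ := ((ENNReal.tendsto_nhds_zero.1 hlim) (ENNReal.ofReal (t / 2))
      (ENNReal.ofReal_pos.2 (by positivity))).exists
    have := measureReal_not_det_pos_le hD hφ hdetφ (n := n) (ε := t / 2) (by positivity)
      fun m hm => by
        obtain ⟨ℓ, rfl⟩ := Nat.exists_eq_add_of_le hm.le
        exact (le_iSup₂ (f := fun (ℓ : ℕ) (_ : 1 ≤ ℓ) =>
          ∫⁻ θ, ENNReal.ofReal (specNorm (ratioDefect φ n (n + ℓ) θ)) ∂leb) ℓ (by omega)).trans hn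
    linarith
  rw [ae_iff]
  exact (measureReal_eq_zero_iff (measure_ne_top _ _)).1 (le_antisymm hle measureReal_nonneg)

end Necessity

end MatrixOPUC

end

theorem lemma3 {p : ℕ} (ρ : MatrixOPUC.MatrixMeasure p)
    (φ : ℕ → (Matrix (Fin p) (Fin p) ℂ)[X]) (hφ : MatrixOPUC.IsLeftOrthonormal ρ φ) :
    (∀ᵐ θ ∂MatrixOPUC.leb, 0 < (ρ.density θ).det) ↔
      Tendsto (fun n : ℕ => ⨆ (ℓ : ℕ) (_ : 1 ≤ ℓ),
          ∫⁻ θ, ENNReal.ofReal (MatrixOPUC.specNorm (MatrixOPUC.ratioDefect φ n (n + ℓ) θ))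
            ∂MatrixOPUC.leb)
        atTop (𝓝 0) := by
  obtain ⟨ν, M, S, hν, hS, hS0, hleb, hMm, hMi, hpsd, hρ, hdens⟩ := ρ.exists_density
  have hD : MatrixOPUC.IsMatrixDensity ν M S := ⟨hν, hS, hS0, hleb, hMm, hMi, hpsd⟩
  have hon := hφ.isOrthonormalFor hMi hρ
  have hdetφ : ∀ n θ, (MatrixOPUC.evalAt (φ n) (MatrixOPUC.circlePt θ)).det ≠ 0 := fun n θ => by
    rw [MatrixOPUC.evalAt_eq]
    exact hon.det_eval_ne_zero (MatrixOPUC.isShiftForm_intForm hMi hpsd) n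
      (MatrixOPUC.norm_circlePt θ)
  have hiff : (∀ᵐ θ ∂MatrixOPUC.leb, 0 < (ρ.density θ).det) ↔
      ∀ᵐ θ ∂MatrixOPUC.leb, 0 < (M θ).det :=
    eventually_congr (hdens.mono fun θ hθ => by rw [hθ])
  exact hiff.trans ⟨MatrixOPUC.tendsto_iSup_lintegral_ratioDefect hD hon hdetφ,
    MatrixOPUC.ae_det_pos_of_tendsto hD hon hdetφ⟩
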